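/- For $n\in\mathbb{N}$, $f:\{-1,1\}^n\to\mathbb{R}$ and $S\subseteq\{1,\ldots,n\}$ let $w_S(x)=\prod_{i\in S}x_i$ and $\hat f(S)=2^{-n}\sum_{y\in\{-1,1\}^n}f(y)w_S(y)$; $f$ has degree at most $d$ if $\hat f(S)=0$ whenever $|S|>d$. There exist universal constants $\kappa\in(0,\infty)$, $c\in(0,1)$ and $\ell_0\in\mathbb{N}$ such that the following holds. Let $n\in\mathbb{N}$ and $d\in\{1,\ldots,n\}$. Then every function $f:\{-1,1\}^n\to[-1,1]$ of degree at most $d$ satisfies, for every $\ell\in\{1,\ldots,d\}$, $$\sum_{\substack{S\subseteq\{1,\ldots,n\}\\ |S|=\ell}}|\hat f(S)|\le \binom{n}{\ell}^{\frac{\ell-1}{2\ell}}e^{\kappa\sqrt{\ell\log\ell}}\,\frac{d^\ell}{\ell!}\qquad\text{and}\qquad \sum_{\substack{S\subseteq\{1,\ldots,n\}\\ |S|=\ell}}|\hat f(S)|\le n^{\frac{\ell-1}{2}}d^\ell\ell^{-c\ell},$$ and moreover, if $\ell\ge\ell_0$, $$\binom{n}{\ell}^{\frac{\ell-1}{2\ell}}e^{\kappa\sqrt{\ell\log\ell}}\,\frac{d^\ell}{\ell!}\le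 n^{\frac{\ell-1}{2}}d^\ell\ell^{-c\ell}.$$ -/

import Mathlib

/-- The discrete hypercube `{-1,1}^n`; the units of `ℤ` are exactly `1` and `-1`. -/
abbrev Hypercube (n : ℕ) : Type := Fin n → ℤˣ

/-- The Walsh function `w_S(x) = ∏_{i ∈ S} x_i`. -/
def walsh {n : ℕ} (S : Finset (Fin n)) (x : Hypercube n) : ℝ :=
  ∏ i ∈ S, (((x i : ℤˣ) : ℤ) : ℝ)

/-- The Fourier coefficient of `f` at `S`, namely `2^{-n} ∑_y f(y) w_S(y)`. -/
noncomputable def walshCoeff {n : ℕ} (f : Hypercube n → ℝ) (S : Finset (Fin n)) : ℝ :=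
  1 / (2 : ℝ) ^ n * ∑ y : Hypercube n, f y * walsh S y

/-- `f` has degree at most `d`: its Fourier coefficients vanish on all sets of size `> d`. -/
def HasDegreeAtMost {n : ℕ} (f : Hypercube n → ℝ) (d : ℕ) : Prop :=
  ∀ S : Finset (Fin n), d < S.card → walshCoeff f S = 0

/-- The `ℓ_1`-norm of the level-`l` Fourier spectrum, `∑_{|S| = l} |f̂(S)|`. -/
noncomputable def levelL1 {n : ℕ} (f : Hypercube n → ℝ) (l : ℕ) : ℝ :=
  ∑ S ∈ Finset.univ.powersetCard l, |walshCoeff f S|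

/-- `binom(n,l)^{(l-1)/(2l)} e^{κ √(l log l)} d^l / l!`. -/
noncomputable def sharpBound (κ : ℝ) (n d l : ℕ) : ℝ :=
  (n.choose l : ℝ) ^ (((l : ℝ) - 1) / (2 * (l : ℝ))) *
    Real.exp (κ * Real.sqrt ((l : ℝ) * Real.log (l : ℝ))) *
    ((d : ℝ) ^ l / (Nat.factorial l : ℝ))

/-- `n^{(l-1)/2} d^l l^{-c l}`. -/
noncomputable def simpleBound (c : ℝ) (n d l : ℕ) : ℝ :=
  (n : ℝ) ^ (((l : ℝ) - 1) / 2) * (d : ℝ) ^ l * (l : ℝ) ^ (-(c * (l : ℝ)))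

/-!
Write `f_l` for the homogeneous part of `f` of degree `l` and `a_S` for its coefficients.

*Size of `f_l`.* For a vertex `z` of the cube, `t ↦ f (t z)` is a polynomial of degree at most `d`
that is bounded by `1` on `[-1, 1]`, and `f_l (z)` is its coefficient of order `l`. V. A. Markov's
inequality (`abs_coeff_le_of_abs_eval_le`) gives `|f_l| ≤ d ^ l / l!`. It remains to bound `∑ |a_S|`
for an `l`-homogeneous polynomial of supremum at most `M` on the cube, in two ways.

*The sharp bound.* Fix `2 ≤ k ≤ l` and let `g_T` be the `L₂` norm of the derivative `∂_T f_l`, for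
`#T = k`. Double counting and Cauchy–Schwarz bound `∑ |a_S|` by `∑ g_T`
(`choose_mul_sum_abs_le`). The derivatives at a fixed point `y` are the coefficients of the
`k`-homogeneous polynomial `x ↦ ∑_T x_T ∂_T f_l (y)`, whose supremum is at most `3 l ^ (2k) M` by
Markov's inequality again (`abs_sum_slice_le`). A Bohnenblust–Hille inequality with constant
`k ^ O(1) · 3 ^ k` applies to it; only its weak form is needed, and that follows from Littlewood's
mixed inequality by an elementary induction over families of sets (`sum_abs_le_card_rpow`).
Since its exponent is close to `2`, passing from `L₂ (y)` to the relevant `L_q (y)` costs only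
`9 ^ (l / k)` by Bonami's lemma and interpolation (`sqrt_expect_sq_le`). The power of `binom(n, l)`
comes out right because `binom(n, l) ^ (1 / l)` is nonincreasing in `l`, and the choice
`k ≈ √(l / log l)` balances `9 ^ (l / k)` against `l ^ O(k)` (`exists_free_index_count`).

*The simple bound.* For large `l` it follows from the sharp one by Stirling's lower bound on `l!`
(`sharpBound_le_simpleBound`), but small `l` need a separate argument, and decoupling treats all `l`
at once. Colour the indices at random with `l` colours. The part of `f_l` that uses each colour once
is a multilinear form bounded by `M` (`abs_sum_rainbowTensor_le`), and the iterated Khinchine–Kahane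
inequality with constant `√2` bounds its mixed `(ℓ₁, ℓ₂)` norm (`sum_sqrt_sum_tensor_sq_le`).
Averaging over a biased colouring yields a constant small enough even for `l = 2`.
-/

namespace CubeFourier

open Finset
open scoped BigOperators

variable {n : ℕ}

/-! ### Fourier analysis on the discrete cube -/

/-- The vertex `x` of the discrete cube, regarded as a point of `ℝⁿ`. -/
def vertex (x : Hypercube n) : Fin n → ℝ := fun i => ((x i : ℤ) : ℝ)

/-- The multilinear polynomial `∑_S a_S ∏_{i ∈ S} z_i` with coefficient family `a`. -/
def multilin (a : Finset (Fin n) → ℝ) (z : Fin n → ℝ) : ℝ := ∑ S, a S * ∏ i ∈ S, z i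

lemma vertex_sq (x : Hypercube n) (i : Fin n) : vertex x i * vertex x i = 1 := by
  unfold vertex
  rcases Int.units_eq_one_or (x i) with h | h <;> simp [h]

lemma abs_vertex (x : Hypercube n) (i : Fin n) : |vertex x i| = 1 := by
  unfold vertex
  rcases Int.units_eq_one_or (x i) with h | h <;> simp [h]

lemma walsh_eq (S : Finset (Fin n)) (x : Hypercube n) : walsh S x = ∏ i ∈ S, vertex x i := rfl

lemma sum_units (g : ℤˣ → ℝ) : ∑ u, g u = g 1 + g (-1) := by
  rw [show (univ : Finset ℤˣ) = {1, -1} from rfl, sum_pair (by decide)]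

lemma sum_cube_prod (φ : Fin n → ℤˣ → ℝ) :
    ∑ x : Hypercube n, ∏ i, φ i (x i) = ∏ i, (φ i 1 + φ i (-1)) := by
  rw [← Fintype.prod_sum]
  exact prod_congr rfl fun i _ => sum_units _

lemma card_cube : (Fintype.card (Hypercube n) : ℝ) = 2 ^ n := by
  simp [Hypercube]

lemma expect_eq (g : Hypercube n → ℝ) : 𝔼 x, g x = 1 / 2 ^ n * ∑ x, g x := by
  rw [Fintype.expect_eq_sum_div_card, card_cube]; ring

lemma expect_cube_prod (φ : Fin n → ℤˣ → ℝ) :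
    𝔼 x : Hypercube n, ∏ i, φ i (x i) = ∏ i, ((φ i 1 + φ i (-1)) / 2) := by
  rw [expect_eq, sum_cube_prod, prod_div_distrib]; simp; ring

lemma prod_ite_univ (S : Finset (Fin n)) (z : Fin n → ℝ) :
    ∏ i ∈ S, z i = ∏ i, if i ∈ S then z i else 1 := by
  rw [prod_ite_mem]; simp

/-- The product kernel `∏ (1 + x_i z_i)` reproduces monomials. -/
lemma expect_kernel_mul_walsh (z : Fin n → ℝ) (S : Finset (Fin n)) :
    𝔼 x : Hypercube n, (∏ i, (1 + vertex x i * z i)) * walsh S x = ∏ i ∈ S, z i := by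
  simp_rw [walsh_eq, prod_ite_univ S, ← prod_mul_distrib]
  have := expect_cube_prod (n := n)
    (fun i u => (1 + ((u : ℤ) : ℝ) * z i) * if i ∈ S then ((u : ℤ) : ℝ) else 1)
  simp only [vertex]
  rw [this]
  refine prod_congr rfl fun i _ => ?_
  by_cases h : i ∈ S <;> simp [h] <;> ring

lemma expect_kernel (z : Fin n → ℝ) :
    𝔼 x : Hypercube n, ∏ i, (1 + vertex x i * z i) = 1 := by
  simpa [walsh] using expect_kernel_mul_walsh z ∅

lemma multilin_eq_expect (a : Finset (Fin n) → ℝ) (z : Fin n → ℝ) :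
    multilin a z = 𝔼 x : Hypercube n, (∏ i, (1 + vertex x i * z i)) * multilin a (vertex x) := by
  simp only [multilin, mul_sum, ← walsh_eq]
  rw [expect_sum_comm]
  refine sum_congr rfl fun S _ => ?_
  rw [← expect_kernel_mul_walsh, mul_expect]
  exact expect_congr rfl fun x _ => by ring

/-- A multilinear polynomial attains its extrema over the solid cube at the vertices. -/
lemma abs_multilin_le {a : Finset (Fin n) → ℝ} {M : ℝ}
    (hM : ∀ x : Hypercube n, |multilin a (vertex x)| ≤ M) {z : Fin n → ℝ} (hz : ∀ i, |z i| ≤ 1) :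
    |multilin a z| ≤ M := by
  have hk : ∀ x : Hypercube n, 0 ≤ ∏ i, (1 + vertex x i * z i) := fun x =>
    prod_nonneg fun i _ => by
      have h1 : |vertex x i * z i| ≤ 1 := by rw [abs_mul, abs_vertex, one_mul]; exact hz i
      linarith [(abs_le.1 h1).1]
  rw [multilin_eq_expect]
  calc _ ≤ 𝔼 x : Hypercube n, |(∏ i, (1 + vertex x i * z i)) * multilin a (vertex x)| :=
        abs_expect_le _ _
    _ ≤ 𝔼 x : Hypercube n, (∏ i, (1 + vertex x i * z i)) * M := by
        refine expect_le_expect fun x _ => ?_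
        rw [abs_mul, abs_of_nonneg (hk x)]
        exact mul_le_mul_of_nonneg_left (hM x) (hk x)
    _ = M := by rw [← expect_mul, expect_kernel, one_mul]

lemma expect_walsh_mul_walsh (S T : Finset (Fin n)) :
    𝔼 x : Hypercube n, walsh S x * walsh T x = if S = T then 1 else 0 := by
  simp_rw [walsh_eq, prod_ite_univ S, prod_ite_univ T, ← prod_mul_distrib]
  have := expect_cube_prod (n := n)
    (fun i u => (if i ∈ S then ((u : ℤ) : ℝ) else 1) * if i ∈ T then ((u : ℤ) : ℝ) else 1)
  simp only [vertex]
  rw [this]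
  split_ifs with h
  · subst h
    refine prod_eq_one fun i _ => ?_
    by_cases h : i ∈ S <;> simp [h]
  · obtain ⟨i, hi⟩ : ∃ i, ¬ (i ∈ S ↔ i ∈ T) := by
      by_contra! h'
      exact h (Finset.ext h')
    refine prod_eq_zero (mem_univ i) ?_
    by_cases h1 : i ∈ S <;> by_cases h2 : i ∈ T <;> simp_all

/-- Parseval's identity. -/
lemma expect_multilin_mul_multilin (a b : Finset (Fin n) → ℝ) :
    𝔼 x : Hypercube n, multilin a (vertex x) * multilin b (vertex x) = ∑ S, a S * b S := by
  have : ∀ x : Hypercube n, multilin a (vertex x) * multilin b (vertex x) =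
      ∑ S, ∑ T, a S * b T * (walsh S x * walsh T x) := fun x => by
    simp only [multilin, ← walsh_eq, sum_mul_sum]
    exact sum_congr rfl fun S _ => sum_congr rfl fun T _ => by ring
  rw [expect_congr rfl fun x _ => this x, expect_sum_comm]
  refine sum_congr rfl fun S _ => ?_
  rw [expect_sum_comm]
  have h2 : ∀ T, 𝔼 x : Hypercube n, a S * b T * (walsh S x * walsh T x) =
      a S * b T * if S = T then 1 else 0 := fun T => by
    rw [← mul_expect, expect_walsh_mul_walsh]
  rw [sum_congr rfl fun T _ => h2 T]
  simp

lemma expect_multilin_sq (a : Finset (Fin n) → ℝ) :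
    𝔼 x : Hypercube n, multilin a (vertex x) ^ 2 = ∑ S, a S ^ 2 := by
  simpa only [sq] using expect_multilin_mul_multilin a a

/-- Fourier inversion on the cube. -/
lemma multilin_walshCoeff (f : Hypercube n → ℝ) (x : Hypercube n) :
    multilin (walshCoeff f) (vertex x) = f x := by
  have key : ∀ y : Hypercube n, ∑ S, walsh S y * walsh S x = if y = x then 2 ^ n else 0 := by
    intro y
    have h1 : ∑ S : Finset (Fin n), walsh S y * walsh S x =
        ∏ i, (1 + vertex y i * vertex x i) := by
      rw [prod_one_add, powerset_univ]
      exact sum_congr rfl fun S _ => by rw [walsh_eq, walsh_eq, prod_mul_distrib]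
    rw [h1]
    split_ifs with h
    · subst h
      simp [vertex_sq]; norm_num
    · obtain ⟨i, hi⟩ : ∃ i, y i ≠ x i := by
        by_contra! h'
        exact h (funext h')
      refine prod_eq_zero (mem_univ i) ?_
      unfold vertex
      rcases Int.units_eq_one_or (x i) with h1 | h1 <;>
        rcases Int.units_eq_one_or (y i) with h2 | h2 <;> simp_all
  simp only [multilin, walshCoeff, ← walsh_eq, sum_mul, mul_sum]
  rw [sum_comm]
  have : ∀ y : Hypercube n, ∑ S, 1 / (2 : ℝ) ^ n * (f y * walsh S y) * walsh S x =
      f y * (1 / 2 ^ n) * ∑ S, walsh S y * walsh S x := fun y => by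
    rw [mul_sum]
    exact sum_congr rfl fun S _ => by ring
  simp_rw [this, key]
  simp

/-! ### Markov's inequality for polynomial coefficients -/

section MarkovCoefficients
open Polynomial

lemma coeff_prod_X_sub_C_sign (u : ℕ → ℝ) (t : Finset ℕ) (hu : ∀ k ∈ t, 0 ≤ u k) (j : ℕ) :
    0 ≤ (-1) ^ (#t + j) * (∏ k ∈ t, (X - C (u k))).coeff j := by
  induction t using Finset.induction_on generalizing j with
  | empty =>
    rcases eq_or_ne j 0 with rfl | hj
    · simp
    · simp [coeff_one, hj]
  | insert a t ha ih =>
    have ih' := fun j => ih (fun k hk => hu k (mem_insert_of_mem hk)) j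
    have h0 := hu a (mem_insert_self a t)
    rw [prod_insert ha, card_insert_of_notMem ha, sub_mul, coeff_sub, coeff_C_mul]
    have h1 := mul_nonneg h0 (ih' j)
    rcases j with _ | j
    · rw [coeff_X_mul_zero]
      simp only [pow_add, pow_one] at h1 ⊢
      linarith
    · rw [coeff_X_mul]
      have h2 := ih' j
      simp only [pow_add, pow_one] at h1 h2 ⊢
      linarith

lemma prod_node_sub_sign {s : ℕ} {u : ℕ → ℝ} (hu : StrictAntiOn u (range (s + 1))) {i : ℕ}
    (hi : i ∈ range (s + 1)) : 0 < (-1) ^ i * ∏ k ∈ (range (s + 1)).erase i, (u i - u k) := by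
  have h : ((-1 : ℝ)) ^ i = ∏ k ∈ (range (s + 1)).erase i, if k < i then (-1 : ℝ) else 1 := by
    rw [prod_ite, prod_const, prod_const_one, mul_one]
    congr 1
    rw [show ((range (s + 1)).erase i).filter (· < i) = range i by
      ext k; simp only [mem_filter, mem_erase, mem_range] at hi ⊢; omega, card_range]
  rw [h, ← prod_mul_distrib]
  refine prod_pos fun k hk => ?_
  obtain ⟨hki, hk⟩ := mem_erase.1 hk
  split_ifs with hlt
  · linarith [hu (mem_coe.2 hk) (mem_coe.2 hi) hlt]
  · linarith [hu (mem_coe.2 hi) (mem_coe.2 hk) (by omega : i < k)]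

/-- If `R` alternates in sign with absolute values `w i` along decreasing nonnegative nodes, then
each coefficient of `R` dominates that of every polynomial bounded by `w` at the nodes: the
coefficients of the Lagrange basis polynomials alternate in sign as well. -/
lemma abs_coeff_le_of_alternating {s : ℕ} {u w : ℕ → ℝ} (hu : StrictAntiOn u (range (s + 1)))
    (hu0 : ∀ i ∈ range (s + 1), 0 ≤ u i) {r R : ℝ[X]} (hr : r.natDegree ≤ s)
    (hR : R.natDegree ≤ s) (hrw : ∀ i ∈ range (s + 1), |r.eval (u i)| ≤ w i)
    (hRw : ∀ i ∈ range (s + 1), R.eval (u i) = (-1) ^ i * w i) (j : ℕ) :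
    |r.coeff j| ≤ |R.coeff j| := by
  set I := range (s + 1) with hI
  set c : ℕ → ℝ := fun i => (Lagrange.basis I u i).coeff j with hc
  have hsign : ∀ i ∈ I, |c i| = (-1) ^ (s + j) * ((-1) ^ i * c i) := by
    intro i hi
    have hb : c i = (∏ k ∈ I.erase i, (u i - u k))⁻¹ *
        (∏ k ∈ I.erase i, (X - C (u k))).coeff j := by
      simp only [hc, Lagrange.basis, Lagrange.basisDivisor, prod_mul_distrib]
      rw [← map_prod, coeff_C_mul, prod_inv_distrib]
    have h1 := prod_node_sub_sign hu hi
    have h2 := coeff_prod_X_sub_C_sign u (I.erase i) (fun k hk => hu0 k (mem_of_mem_erase hk)) j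
    rw [card_erase_of_mem hi, hI, card_range, Nat.add_sub_cancel] at h2
    have h3 : 0 ≤ (-1) ^ (s + j) * ((-1) ^ i * c i) := by
      rw [hb]
      have h4 : 0 ≤ ((-1) ^ i * ∏ k ∈ I.erase i, (u i - u k))⁻¹ := (inv_pos.2 h1).le
      have h5 := mul_nonneg h4 h2
      rw [mul_inv] at h5
      have h6 : ((-1 : ℝ) ^ i)⁻¹ = (-1) ^ i := by
        rw [← inv_pow]; norm_num
      rw [h6] at h5
      calc _ ≤ _ := h5
        _ = _ := by ring
    rw [← abs_of_nonneg h3, abs_mul, abs_mul, abs_pow, abs_pow]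
    simp
  have hexp : ∀ p : ℝ[X], p.natDegree ≤ s → p.coeff j = ∑ i ∈ I, p.eval (u i) * c i := by
    intro p hp
    have h1 : p.degree < #I := by
      rw [hI, card_range]
      exact lt_of_le_of_lt degree_le_natDegree (by exact_mod_cast Nat.lt_succ_of_le hp)
    conv_lhs => rw [Lagrange.eq_interpolate hu.injOn h1]
    rw [Lagrange.interpolate_apply, finsetSum_coeff]
    exact sum_congr rfl fun i _ => by rw [coeff_C_mul]
  rw [hexp r hr, hexp R hR]
  calc |∑ i ∈ I, r.eval (u i) * c i| ≤ ∑ i ∈ I, |r.eval (u i) * c i| := abs_sum_le_sum_abs _ _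
    _ ≤ ∑ i ∈ I, w i * |c i| := sum_le_sum fun i hi => by
        rw [abs_mul]; exact mul_le_mul_of_nonneg_right (hrw i hi) (abs_nonneg _)
    _ = (-1) ^ (s + j) * ∑ i ∈ I, R.eval (u i) * c i := by
        rw [mul_sum]
        exact sum_congr rfl fun i hi => by rw [hsign i hi, hRw i hi]; ring
    _ ≤ |(-1) ^ (s + j) * ∑ i ∈ I, R.eval (u i) * c i| := le_abs_self _
    _ = _ := by rw [abs_mul, abs_pow]; simp

/-- The decomposition of a polynomial into its even and odd parts. -/
lemma eval_eq_contract (p : ℝ[X]) (x : ℝ) :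
    p.eval x = (contract 2 p).eval (x ^ 2) + x * (contract 2 (divX p)).eval (x ^ 2) := by
  have h : p = expand ℝ 2 (contract 2 p) + X * expand ℝ 2 (contract 2 (divX p)) := by
    ext k
    rcases k with _ | k
    · simp [coeff_expand, coeff_contract]
    · rw [coeff_add, coeff_X_mul, coeff_expand two_pos, coeff_expand two_pos, coeff_contract
        two_ne_zero, coeff_contract two_ne_zero, coeff_divX]
      by_cases h : 2 ∣ k + 1
      · rw [if_pos h, if_neg (by omega), Nat.div_mul_cancel h, add_zero]
      · rw [if_neg h, if_pos (by omega), Nat.div_mul_cancel (by omega), zero_add]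
  conv_lhs => rw [h]
  simp [expand_eval]

lemma eval_contract_even (p : ℝ[X]) (x : ℝ) :
    (contract 2 p).eval (x ^ 2) = (p.eval x + p.eval (-x)) / 2 := by
  rw [eval_eq_contract p x, eval_eq_contract p (-x), neg_sq]; ring

lemma eval_contract_odd (p : ℝ[X]) (x : ℝ) :
    x * (contract 2 (divX p)).eval (x ^ 2) = (p.eval x - p.eval (-x)) / 2 := by
  rw [eval_eq_contract p x, eval_eq_contract p (-x), neg_sq]; ring

/-- The differential equation of the Chebyshev polynomials gives
`T⁽ˡ⁺²⁾(0) = -(N² - l²) T⁽ˡ⁾(0)`, so that `|T⁽ˡ⁾(0)| ≤ N ^ l` by induction in steps of two. -/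
lemma abs_coeff_T_le (N l : ℕ) : |(Chebyshev.T ℝ N).coeff l| ≤ (N : ℝ) ^ l / l.factorial := by
  have hc : ∀ l, (derivative^[l] (Chebyshev.T ℝ N)).eval 0 =
      l.factorial * (Chebyshev.T ℝ N).coeff l := fun l => by
    rw [← coeff_zero_eq_eval_zero, coeff_iterate_derivative]
    simp [Nat.descFactorial_self]
  have hd : ∀ l, l ≤ N → |(derivative^[l] (Chebyshev.T ℝ N)).eval 0| ≤ (N : ℝ) ^ l := by
    intro l
    induction l using Nat.twoStepInduction with
    | zero =>
      intro _
      simpa using Chebyshev.abs_eval_T_real_le_one N (x := 0) (by simp)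
    | one =>
      intro _
      rw [Function.iterate_one, Chebyshev.T_derivative_eq_U, eval_mul, Chebyshev.U_eval_zero,
        abs_mul]
      have h1 : |((if Even ((N : ℤ) - 1) then (((N : ℤ) - 1) / 2).negOnePow else 0 : ℤ) : ℝ)| ≤
          1 := by
        split_ifs
        · rcases Int.units_eq_one_or (((N : ℤ) - 1) / 2).negOnePow with h | h <;> simp [h]
        · simp
      simpa using mul_le_mul_of_nonneg_left h1 (Nat.cast_nonneg (α := ℝ) N)
    | more l ih _ =>
      intro hl
      rw [Chebyshev.iterate_derivative_T_eval_zero_recurrence, abs_mul, abs_neg]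
      have h1 : ((l : ℝ)) ^ 2 ≤ (N : ℝ) ^ 2 := by gcongr; omega
      rw [abs_of_nonneg (by push_cast; linarith), pow_add, mul_comm]
      refine mul_le_mul (ih (by omega)) ?_ ?_ (by positivity)
      · push_cast; nlinarith
      · push_cast; linarith
  rcases le_or_gt l N with h | h
  · rw [le_div_iff₀ (by positivity), ← abs_of_nonneg (by positivity : (0 : ℝ) ≤ l.factorial),
      ← abs_mul, mul_comm, ← hc]
    exact hd l h
  · rw [coeff_eq_zero_of_natDegree_lt (by simpa using h), abs_zero]
    positivity

lemma node_nonneg {N i : ℕ} (hi : 2 * i ≤ N) : 0 ≤ Chebyshev.node N i := by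
  refine Real.cos_nonneg_of_mem_Icc ⟨?_, ?_⟩
  · have : (0 : ℝ) ≤ i * Real.pi / N := by positivity
    linarith [Real.pi_pos]
  · rcases Nat.eq_zero_or_pos N with rfl | hN
    · simp; positivity
    · rw [div_le_iff₀ (by exact_mod_cast hN)]
      have : (2 * i : ℝ) ≤ N := by exact_mod_cast hi
      nlinarith [Real.pi_pos]

lemma node_pos {N i : ℕ} (hi : 2 * i < N) : 0 < Chebyshev.node N i := by
  have hN : (0 : ℝ) < N := by exact_mod_cast (by omega : 0 < N)
  have h2 : (2 * i : ℝ) < N := by exact_mod_cast hi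
  refine Real.cos_pos_of_mem_Ioo ⟨?_, ?_⟩
  · have : (0 : ℝ) ≤ i * Real.pi / N := by positivity
    linarith [Real.pi_pos]
  · rw [div_lt_iff₀ hN]
    nlinarith [Real.pi_pos]

lemma strictAntiOn_node_sq {N s : ℕ} (hs : 2 * s ≤ N) :
    StrictAntiOn (fun i => Chebyshev.node N i ^ 2) (range (s + 1)) := by
  intro i hi j hj hij
  simp only [coe_range, Set.mem_Iio] at hi hj
  have := Chebyshev.node_lt (n := N) (i := i) (j := j) (by omega) hij
  exact pow_lt_pow_left₀ this (node_nonneg (by omega)) two_ne_zero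

/-- V. A. Markov's inequality for the coefficients of a polynomial bounded on `[-1, 1]`, in the
closed form that results from estimating the coefficients of the Chebyshev polynomials. The even
and the odd part of `p` are polynomials in `x ^ 2` (up to a factor `x`), and they are compared with
the Chebyshev polynomial of the same parity at the squares of its nonnegative extremal points. -/
theorem abs_coeff_le_of_abs_eval_le {p : ℝ[X]} {d : ℕ} {M : ℝ} (hd : p.natDegree ≤ d)
    (hM : ∀ x : ℝ, |x| ≤ 1 → |p.eval x| ≤ M) (l : ℕ) :
    |p.coeff l| ≤ M * ((d : ℝ) ^ l / l.factorial) := by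
  have hM0 : 0 ≤ M := (abs_nonneg _).trans (hM 0 (by simp))
  rcases lt_or_ge d l with hl | hl
  · rw [coeff_eq_zero_of_natDegree_lt (hd.trans_lt hl), abs_zero]
    positivity
  suffices h : ∃ N ≤ d, |p.coeff l| ≤ M * |(Chebyshev.T ℝ N).coeff l| by
    obtain ⟨N, hN, h⟩ := h
    refine h.trans (mul_le_mul_of_nonneg_left ((abs_coeff_T_le N l).trans ?_) hM0)
    gcongr
  have hnode : ∀ N i, |Chebyshev.node N i| ≤ 1 := fun N i => Real.abs_cos_le_one _
  rcases Nat.even_or_odd' l with ⟨j, rfl | rfl⟩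
  · set s := d / 2
    refine ⟨2 * s, by omega, ?_⟩
    set N := 2 * s with hN
    have hdeg : ∀ q : ℝ[X], q.natDegree ≤ d → (contract 2 q).natDegree ≤ s := fun q hq => by
      refine natDegree_le_iff_coeff_eq_zero.2 fun k hk => ?_
      rw [coeff_contract two_ne_zero]
      exact coeff_eq_zero_of_natDegree_lt (by omega)
    have key := abs_coeff_le_of_alternating (r := contract 2 p)
      (R := C M * contract 2 (Chebyshev.T ℝ N)) (w := fun _ => M)
      (strictAntiOn_node_sq (N := N) (s := s) le_rfl) (fun i _ => sq_nonneg _) (hdeg p hd)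
      ((natDegree_C_mul_le _ _).trans (hdeg _ (by rw [Chebyshev.natDegree_T]; omega))) ?_ ?_ j
    · rw [coeff_C_mul, coeff_contract two_ne_zero, coeff_contract two_ne_zero, abs_mul,
        abs_of_nonneg hM0, mul_comm j] at key
      exact key
    · intro i _
      rw [eval_contract_even, abs_div, abs_two, div_le_iff₀ two_pos]
      have h1 := hM _ (hnode N i)
      have h2 := hM (-Chebyshev.node N i) (by rw [abs_neg]; exact hnode N i)
      linarith [abs_add_le (p.eval (Chebyshev.node N i)) (p.eval (-Chebyshev.node N i))]
    · intro i hi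
      have hiN : i ∈ Finset.Iic N := by
        simp only [mem_range] at hi
        simp only [mem_Iic]; omega
      rw [eval_C_mul, eval_contract_even, Chebyshev.T_eval_neg, Chebyshev.eval_T_real_node hiN,
        Int.negOnePow_even _ (by rw [hN]; simp)]
      simp; ring
  · set s := (d - 1) / 2
    refine ⟨2 * s + 1, by omega, ?_⟩
    set N := 2 * s + 1 with hN
    have hdeg : ∀ q : ℝ[X], q.natDegree ≤ d → (contract 2 (divX q)).natDegree ≤ s := fun q hq => by
      refine natDegree_le_iff_coeff_eq_zero.2 fun k hk => ?_
      rw [coeff_contract two_ne_zero, coeff_divX]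
      exact coeff_eq_zero_of_natDegree_lt (by omega)
    have hpos : ∀ i ∈ range (s + 1), 0 < Chebyshev.node N i := fun i hi =>
      node_pos (by rw [mem_range] at hi; omega)
    have key := abs_coeff_le_of_alternating (r := contract 2 (divX p))
      (R := C M * contract 2 (divX (Chebyshev.T ℝ N))) (w := fun i => M / Chebyshev.node N i)
      (strictAntiOn_node_sq (N := N) (s := s) (by omega)) (fun i _ => sq_nonneg _) (hdeg p hd)
      ((natDegree_C_mul_le _ _).trans (hdeg _ (by rw [Chebyshev.natDegree_T]; omega))) ?_ ?_ j
    · rw [coeff_C_mul, coeff_contract two_ne_zero, coeff_contract two_ne_zero, coeff_divX,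
        coeff_divX, abs_mul, abs_of_nonneg hM0, mul_comm j] at key
      exact key
    · intro i hi
      rw [le_div_iff₀ (hpos i hi), ← abs_of_pos (hpos i hi), ← abs_mul, abs_of_pos (hpos i hi),
        mul_comm, eval_contract_odd, abs_div, abs_two, div_le_iff₀ two_pos]
      have h1 := hM _ (hnode N i)
      have h2 := hM (-Chebyshev.node N i) (by rw [abs_neg]; exact hnode N i)
      linarith [abs_sub (p.eval (Chebyshev.node N i)) (p.eval (-Chebyshev.node N i))]
    · intro i hi
      have hiN : i ∈ Finset.Iic N := by
        simp only [mem_range] at hi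
        simp only [mem_Iic]; omega
      have h1 := eval_contract_odd (Chebyshev.T ℝ N) (Chebyshev.node N i)
      rw [Chebyshev.T_eval_neg, Chebyshev.eval_T_real_node hiN,
        Int.negOnePow_odd _ (by rw [hN]; simp)] at h1
      have h2 := (hpos i hi).ne'
      rw [eval_C_mul]
      field_simp
      rw [mul_assoc, h1]
      simp

end MarkovCoefficients

/-! ### Homogeneous parts and Taylor coefficients -/

/-- The coefficient family of the degree-`m` homogeneous part of `multilin a`. -/
def homPart (a : Finset (Fin n) → ℝ) (m : ℕ) : Finset (Fin n) → ℝ :=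
  fun S => if #S = m then a S else 0

/-- The coefficient family of the iterated partial derivative `∂_T (multilin a)`, whose monomial
`z_U` (with `U` disjoint from `T`) has coefficient `a (T ∪ U)`. -/
def slice (a : Finset (Fin n) → ℝ) (T : Finset (Fin n)) : Finset (Fin n) → ℝ :=
  fun U => if Disjoint T U then a (T ∪ U) else 0

lemma homPart_of_card_ne (a : Finset (Fin n) → ℝ) (m : ℕ) :
    ∀ S, #S ≠ m → homPart a m S = 0 := fun _ h => if_neg h

lemma slice_of_card_ne {a : Finset (Fin n) → ℝ} {m : ℕ} (ha : ∀ S, #S ≠ m → a S = 0)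
    (T U : Finset (Fin n)) (h : #U + #T ≠ m) : slice a T U = 0 := by
  unfold slice
  split_ifs with hd
  · exact ha _ (by rw [card_union_of_disjoint hd]; omega)
  · rfl

open Polynomial in
/-- For a polynomial bounded by `M` on the cube, the homogeneous parts obey Markov's bound:
they are the coefficients of the restriction to a line through the origin. -/
lemma abs_multilin_homPart_le {a : Finset (Fin n) → ℝ} {d : ℕ} {M : ℝ}
    (ha : ∀ S, d < #S → a S = 0) (hM : ∀ x : Hypercube n, |multilin a (vertex x)| ≤ M) (l : ℕ)
    {z : Fin n → ℝ} (hz : ∀ i, |z i| ≤ 1) :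
    |multilin (homPart a l) z| ≤ M * ((d : ℝ) ^ l / l.factorial) := by
  set p : ℝ[X] := ∑ S, monomial (#S) (a S * ∏ i ∈ S, z i) with hp
  have hcoeff : p.coeff l = multilin (homPart a l) z := by
    rw [hp, finsetSum_coeff]
    refine sum_congr rfl fun S _ => ?_
    rw [coeff_monomial, homPart, ite_mul, zero_mul]
  have heval : ∀ t, p.eval t = multilin a (fun i => t * z i) := fun t => by
    rw [hp, eval_finsetSum]
    refine sum_congr rfl fun S _ => ?_
    rw [eval_monomial, prod_mul_distrib, prod_const]; ring
  rw [← hcoeff]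
  refine abs_coeff_le_of_abs_eval_le ?_ (fun t ht => ?_) l
  · refine natDegree_sum_le_of_forall_le _ _ fun S _ => ?_
    rcases le_or_gt (#S) d with h | h
    · exact (natDegree_monomial_le _).trans h
    · simp [ha S h]
  · rw [heval]
    refine abs_multilin_le hM fun i => ?_
    rw [abs_mul]
    exact mul_le_one₀ ht (abs_nonneg _) (hz i)

lemma sum_disjoint_eq_sum_superset (T : Finset (Fin n)) (g : Finset (Fin n) → Finset (Fin n) → ℝ) :
    ∑ U, (if Disjoint T U then g (T ∪ U) U else 0) = ∑ S with T ⊆ S, g S (S \ T) := by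
  rw [← sum_filter]
  refine sum_nbij' (fun U => T ∪ U) (fun S => S \ T) ?_ ?_ ?_ ?_ ?_
  · intro U _
    simp
  · intro S _
    simp [disjoint_sdiff]
  · intro U hU
    simp only [mem_filter, mem_univ, true_and] at hU
    exact union_sdiff_cancel_left hU
  · intro S hS
    simp only [mem_filter, mem_univ, true_and] at hS
    exact union_sdiff_of_subset hS
  · intro U hU
    simp only [mem_filter, mem_univ, true_and] at hU
    rw [union_sdiff_cancel_left hU]

lemma multilin_slice (a : Finset (Fin n) → ℝ) (T : Finset (Fin n)) (y : Fin n → ℝ) :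
    multilin (slice a T) y = ∑ S with T ⊆ S, a S * ∏ i ∈ S \ T, y i := by
  rw [← sum_disjoint_eq_sum_superset T fun S U => a S * ∏ i ∈ U, y i]
  exact sum_congr rfl fun U _ => by rw [slice, ite_mul, zero_mul]

lemma sum_slice_sq (a : Finset (Fin n) → ℝ) (T : Finset (Fin n)) :
    ∑ U, slice a T U ^ 2 = ∑ S with T ⊆ S, a S ^ 2 := by
  rw [← sum_disjoint_eq_sum_superset T fun S _ => a S ^ 2]
  refine sum_congr rfl fun U _ => ?_
  unfold slice
  split_ifs <;> simp

/-- The Taylor expansion of a multilinear polynomial. -/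
lemma multilin_add_mul (a : Finset (Fin n) → ℝ) (x y : Fin n → ℝ) (t : ℝ) :
    multilin a (fun i => y i + t * x i) =
      ∑ T, t ^ #T * ((∏ i ∈ T, x i) * multilin (slice a T) y) := by
  have h1 : ∀ T : Finset (Fin n), t ^ #T * ((∏ i ∈ T, x i) * multilin (slice a T) y) =
      ∑ S with T ⊆ S, a S * ((∏ i ∈ T, t * x i) * ∏ i ∈ S \ T, y i) := fun T => by
    rw [multilin_slice, mul_sum, mul_sum]
    refine sum_congr rfl fun S _ => ?_
    rw [prod_mul_distrib, prod_const]; ring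
  simp_rw [h1]
  unfold multilin
  have h2 : ∀ S : Finset (Fin n), a S * ∏ i ∈ S, (y i + t * x i) =
      ∑ T ∈ S.powerset, a S * ((∏ i ∈ T, t * x i) * ∏ i ∈ S \ T, y i) := fun S => by
    rw [← mul_sum, ← prod_add]
    congr 1
    exact prod_congr rfl fun i _ => add_comm _ _
  simp_rw [h2]
  exact sum_comm' (by simp)

lemma multilin_smul {a : Finset (Fin n) → ℝ} {m : ℕ} (ha : ∀ S, #S ≠ m → a S = 0)
    (c : ℝ) (z : Fin n → ℝ) : multilin a (fun i => c * z i) = c ^ m * multilin a z := by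
  unfold multilin
  rw [mul_sum]
  refine sum_congr rfl fun S _ => ?_
  by_cases h : #S = m
  · rw [prod_mul_distrib, prod_const, h]; ring
  · simp [ha S h]

open Polynomial in
/-- Polarization with a bound polynomial in the degree: the part of order `k` in the Taylor
expansion of an `m`-homogeneous polynomial. Markov's coefficient inequality is applied to
`t ↦ P (y + (t / m) x)`, which is at most `(1 + 1 / m) ^ m ≤ e` times the supremum. -/
lemma abs_sum_slice_le {a : Finset (Fin n) → ℝ} {m : ℕ} (hm : 1 ≤ m) {M : ℝ}
    (ha : ∀ S, #S ≠ m → a S = 0) (hM : ∀ x : Hypercube n, |multilin a (vertex x)| ≤ M)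
    {x y : Fin n → ℝ} (hx : ∀ i, |x i| ≤ 1) (hy : ∀ i, |y i| ≤ 1) (k : ℕ) :
    |∑ T ∈ powersetCard k univ, (∏ i ∈ T, x i) * multilin (slice a T) y| ≤
      3 * (m : ℝ) ^ (2 * k) * M := by
  have hm0 : (0 : ℝ) < m := by exact_mod_cast hm
  have hM0 : 0 ≤ M := (abs_nonneg _).trans (hM 1)
  set p : ℝ[X] := ∑ T : Finset (Fin n),
    monomial (#T) ((1 / m : ℝ) ^ #T * ((∏ i ∈ T, x i) * multilin (slice a T) y)) with hp
  have hcoeff : p.coeff k = (1 / m : ℝ) ^ k *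
      ∑ T ∈ powersetCard k univ, (∏ i ∈ T, x i) * multilin (slice a T) y := by
    rw [hp, finsetSum_coeff, powersetCard_eq_filter, powerset_univ, sum_filter, mul_sum]
    refine sum_congr rfl fun S _ => ?_
    rw [coeff_monomial]
    split_ifs with h
    · rw [h]
    · simp
  have heval : ∀ t, p.eval t = multilin a (fun i => y i + t * (1 / m) * x i) := fun t => by
    rw [hp, eval_finsetSum, multilin_add_mul]
    refine sum_congr rfl fun S _ => ?_
    rw [eval_monomial, mul_pow]; ring
  have hdeg : p.natDegree ≤ m := by
    refine natDegree_sum_le_of_forall_le _ _ fun T _ => ?_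
    rcases le_or_gt (#T) m with h | h
    · exact (natDegree_monomial_le _).trans h
    · have : multilin (slice a T) y = 0 :=
        sum_eq_zero fun U _ => by rw [slice_of_card_ne ha T U (by omega), zero_mul]
      simp [this]
  have hexp : (1 + 1 / m : ℝ) ^ m ≤ 3 := by
    calc (1 + 1 / m : ℝ) ^ m ≤ (Real.exp (1 / m)) ^ m := by
          gcongr; linarith [Real.add_one_le_exp (1 / m : ℝ)]
      _ = Real.exp 1 := by rw [← Real.exp_nat_mul]; congr 1; field_simp
      _ ≤ 3 := by linarith [Real.exp_one_lt_d9]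
  have hbd : ∀ t : ℝ, |t| ≤ 1 → |p.eval t| ≤ 3 * M := by
    intro t ht
    have hc : (0 : ℝ) < 1 + 1 / m := by positivity
    have h1 : (fun i => y i + t * (1 / m) * x i) =
        fun i => (1 + 1 / m) * ((y i + t * (1 / m) * x i) / (1 + 1 / m)) := by
      funext i; field_simp
    rw [heval, h1, multilin_smul ha, abs_mul, abs_of_pos (pow_pos hc m)]
    refine mul_le_mul hexp (abs_multilin_le hM fun i => ?_) (abs_nonneg _) (by norm_num)
    rw [abs_div, abs_of_pos hc, div_le_one hc]
    calc |y i + t * (1 / m) * x i| ≤ |y i| + |t * (1 / m) * x i| := abs_add_le _ _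
      _ ≤ 1 + 1 * (1 / m) * 1 := by
        rw [abs_mul, abs_mul, abs_of_pos (by positivity : (0 : ℝ) < 1 / m)]
        gcongr
        · exact hy i
        · exact hx i
      _ = _ := by ring
  have key := abs_coeff_le_of_abs_eval_le hdeg hbd k
  rw [hcoeff, abs_mul, abs_of_nonneg (by positivity), one_div, inv_pow,
    inv_mul_le_iff₀ (by positivity)] at key
  refine key.trans ?_
  have h1 : (m : ℝ) ^ k / k.factorial ≤ m ^ k :=
    div_le_self (by positivity) (by exact_mod_cast Nat.factorial_pos k)
  calc (m : ℝ) ^ k * (3 * M * (m ^ k / k.factorial)) ≤ m ^ k * (3 * M * m ^ k) := by gcongr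
    _ = _ := by ring

/-! ### Bonami's lemma and comparison of moments -/

lemma vertex_mul_flip (i j : Fin n) (x : Hypercube n) :
    vertex (x * Pi.mulSingle i (-1)) j = if j = i then -vertex x i else vertex x j := by
  unfold vertex
  split_ifs with h
  · subst h; simp
  · simp [h]

lemma walsh_mul_flip {i : Fin n} {S : Finset (Fin n)} (hi : i ∉ S) (x : Hypercube n) :
    walsh S (x * Pi.mulSingle i (-1)) = walsh S x := by
  rw [walsh_eq, walsh_eq]
  refine prod_congr rfl fun j hj => ?_
  rw [vertex_mul_flip, if_neg (by rintro rfl; exact hi hj)]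

lemma expect_vertex_mul_eq_zero {i : Fin n} {G : Hypercube n → ℝ}
    (hG : ∀ x, G (x * Pi.mulSingle i (-1)) = G x) : 𝔼 x, vertex x i * G x = 0 := by
  have h : 𝔼 x, vertex x i * G x = 𝔼 x, -(vertex x i * G x) := by
    refine Fintype.expect_equiv (Equiv.mulRight (Pi.mulSingle i (-1))) _ _ fun x => ?_
    rw [Equiv.coe_mulRight, hG, vertex_mul_flip, if_pos rfl]; ring
  rw [expect_neg_distrib] at h
  linarith

lemma fourth_moment_le_of_subset (V : Finset (Fin n)) : ∀ (d : ℕ) (a : Finset (Fin n) → ℝ),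
    (∀ S ⊆ V, d < #S → a S = 0) →
    𝔼 x : Hypercube n, (∑ S ∈ V.powerset, a S * walsh S x) ^ 4 ≤
      9 ^ d * (𝔼 x : Hypercube n, (∑ S ∈ V.powerset, a S * walsh S x) ^ 2) ^ 2 := by
  induction V using Finset.induction_on with
  | empty =>
    intro d a _
    simp only [powerset_empty, sum_singleton, walsh, prod_empty, mul_one, Fintype.expect_const]
    have : (1 : ℝ) ≤ 9 ^ d := one_le_pow₀ (by norm_num)
    nlinarith [pow_nonneg (sq_nonneg (a ∅)) 2]
  | insert i V hi ih =>
    intro d a ha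
    set g : Hypercube n → ℝ := fun x => ∑ S ∈ V.powerset, a S * walsh S x with hg
    set h : Hypercube n → ℝ := fun x => ∑ S ∈ V.powerset, a (insert i S) * walsh S x with hh
    have hF : ∀ x : Hypercube n, ∑ S ∈ (insert i V).powerset, a S * walsh S x =
        g x + vertex x i * h x := fun x => by
      rw [sum_powerset_insert hi, hg, hh, mul_sum]
      congr 1
      refine sum_congr rfl fun S hS => ?_
      rw [walsh_eq, prod_insert fun h' => hi (mem_powerset.1 hS h'), walsh_eq]; ring
    simp only [hF]
    have ihg := ih d a fun S hS => ha S (hS.trans (subset_insert _ _))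
    rcases d with _ | d
    · have h0 : ∀ x, h x = 0 := fun x => sum_eq_zero fun S hS => by
        rw [ha _ (insert_subset_insert _ (mem_powerset.1 hS)) (card_pos.2 (insert_nonempty _ _)),
          zero_mul]
      simpa only [h0, mul_zero, add_zero] using ihg
    have ihh := ih d (fun S => a (insert i S)) fun S hS hd =>
      ha _ (insert_subset_insert _ hS) (by
        rw [card_insert_of_notMem fun h' => hi (hS h')]; omega)
    have hflip : ∀ (b : Finset (Fin n) → ℝ) (x : Hypercube n),
        ∑ S ∈ V.powerset, b S * walsh S (x * Pi.mulSingle i (-1)) =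
          ∑ S ∈ V.powerset, b S * walsh S x := fun b x => sum_congr rfl fun S hS => by
      rw [walsh_mul_flip fun h' => hi (mem_powerset.1 hS h')]
    have hgf : ∀ x, g (x * Pi.mulSingle i (-1)) = g x := hflip a
    have hhf : ∀ x, h (x * Pi.mulSingle i (-1)) = h x := hflip _
    set G := 𝔼 x, g x ^ 2
    set H := 𝔼 x, h x ^ 2
    have hG : 0 ≤ G := expect_nonneg fun x _ => sq_nonneg _
    have hH : 0 ≤ H := expect_nonneg fun x _ => sq_nonneg _
    have e2 : 𝔼 x, (g x + vertex x i * h x) ^ 2 = G + H := by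
      have h1 : ∀ x : Hypercube n, (g x + vertex x i * h x) ^ 2 =
          (g x ^ 2 + h x ^ 2) + vertex x i * (2 * (g x * h x)) := fun x => by
        linear_combination h x ^ 2 * vertex_sq x i
      rw [expect_congr rfl fun x _ => h1 x, expect_add_distrib, expect_add_distrib,
        expect_vertex_mul_eq_zero (fun x => by rw [hgf, hhf]), add_zero]
    have e4 : 𝔼 x, (g x + vertex x i * h x) ^ 4 =
        𝔼 x, g x ^ 4 + 6 * 𝔼 x, g x ^ 2 * h x ^ 2 + 𝔼 x, h x ^ 4 := by
      have h1 : ∀ x : Hypercube n, (g x + vertex x i * h x) ^ 4 =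
          (g x ^ 4 + 6 * (g x ^ 2 * h x ^ 2) + h x ^ 4) +
            vertex x i * (4 * (g x ^ 3 * h x) + 4 * (g x * h x ^ 3)) := fun x => by
        linear_combination (h x ^ 4 * (vertex x i * vertex x i + 1) + 6 * g x ^ 2 * h x ^ 2 +
          4 * vertex x i * g x * h x ^ 3) * vertex_sq x i
      rw [expect_congr rfl fun x _ => h1 x, expect_add_distrib,
        expect_vertex_mul_eq_zero (fun x => by rw [hgf, hhf]), add_zero, expect_add_distrib,
        expect_add_distrib, mul_expect]
    have hcs : 𝔼 x, g x ^ 2 * h x ^ 2 ≤ 3 * 9 ^ d * (G * H) := by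
      have h1 := expect_mul_sq_le_sq_mul_sq univ (fun x => g x ^ 2) (fun x => h x ^ 2)
      simp only [← pow_mul, Nat.reduceMul] at h1
      refine le_of_sq_le_sq ?_ (mul_nonneg (by positivity) (mul_nonneg hG hH))
      calc _ ≤ _ := h1
        _ ≤ (9 ^ (d + 1) * G ^ 2) * (9 ^ d * H ^ 2) :=
          mul_le_mul ihg ihh (expect_nonneg fun x _ => by positivity) (by positivity)
        _ = _ := by ring
    rw [e2, e4]
    have h9 : (0 : ℝ) ≤ 9 ^ d := by positivity
    calc _ ≤ 9 ^ (d + 1) * G ^ 2 + 6 * (3 * 9 ^ d * (G * H)) + 9 ^ d * H ^ 2 := by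
          gcongr
      _ ≤ _ := by
          rw [pow_succ]
          nlinarith [mul_nonneg h9 (sq_nonneg H)]

/-- Bonami's lemma: the `(2, 4)`-hypercontractive estimate for polynomials of degree at most `d`
on the discrete cube, by induction on the number of variables. -/
theorem expect_multilin_pow_four_le {a : Finset (Fin n) → ℝ} {d : ℕ}
    (ha : ∀ S, d < #S → a S = 0) :
    𝔼 x : Hypercube n, multilin a (vertex x) ^ 4 ≤
      9 ^ d * (𝔼 x : Hypercube n, multilin a (vertex x) ^ 2) ^ 2 := by
  simpa only [powerset_univ, multilin, ← walsh_eq] using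
    fourth_moment_le_of_subset univ d a fun S _ => ha S

/-- Comparison of the second moment with the moment of order `2κ / (κ + 2) < 2` for functions
whose fourth moment is controlled by the second: interpolate the second moment between the two
others. The loss `B ^ (1 / κ)` tends to `1` as the order approaches `2`. -/
theorem sqrt_expect_sq_le {ι : Type*} [Fintype ι] {F : ι → ℝ} {B κ : ℝ} (hκ : 0 < κ) (hB : 0 ≤ B)
    (hF : 𝔼 x, F x ^ 4 ≤ B * (𝔼 x, F x ^ 2) ^ 2) :
    √(𝔼 x, F x ^ 2) ≤ B ^ (1 / κ) * (𝔼 x, |F x| ^ (2 * κ / (κ + 2))) ^ ((κ + 2) / (2 * κ)) := by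
  set A := 𝔼 x, F x ^ 2
  set Q := 𝔼 x, |F x| ^ (2 * κ / (κ + 2))
  have hQ : 0 ≤ Q := expect_nonneg fun x _ => by positivity
  have hA : 0 ≤ A := expect_nonneg fun x _ => sq_nonneg _
  rcases hA.eq_or_lt with h0 | hA
  · rw [← h0, Real.sqrt_zero]; positivity
  have hp : (1 : ℝ) ≤ (κ + 4) / 2 := by linarith
  have h1 := Real.compact_inner_le_weight_mul_Lp_of_nonneg univ hp
    (w := fun x => |F x| ^ (2 * κ / (κ + 2))) (f := fun x => |F x| ^ (4 / (κ + 2)))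
    (fun x => by positivity) (fun x => by positivity)
  have h2 : ∀ x, |F x| ^ (2 * κ / (κ + 2)) * |F x| ^ (4 / (κ + 2)) = F x ^ 2 := fun x => by
    rw [← Real.rpow_add_of_nonneg (abs_nonneg _) (by positivity) (by positivity),
      show 2 * κ / (κ + 2) + 4 / (κ + 2) = (2 : ℕ) by field_simp; push_cast; ring,
      Real.rpow_natCast, sq_abs]
  have h3 : ∀ x, |F x| ^ (2 * κ / (κ + 2)) * (|F x| ^ (4 / (κ + 2))) ^ ((κ + 4) / 2) =
      F x ^ 4 := fun x => by
    rw [← Real.rpow_mul (abs_nonneg _),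
      ← Real.rpow_add_of_nonneg (abs_nonneg _) (by positivity) (by positivity),
      show 2 * κ / (κ + 2) + 4 / (κ + 2) * ((κ + 4) / 2) = (4 : ℕ) by
        field_simp; push_cast; ring,
      Real.rpow_natCast, Even.pow_abs (by decide)]
  simp only [h2, h3] at h1
  have h4 : A ≤ Q ^ (1 - ((κ + 4) / 2)⁻¹) * (B * A ^ 2) ^ ((κ + 4) / 2)⁻¹ :=
    h1.trans (by gcongr)
  have h5 : A ^ ((κ + 4) / 2) ≤ Q ^ ((κ + 2) / 2) * (B * A ^ 2) := by
    have := Real.rpow_le_rpow hA.le h4 (by linarith : 0 ≤ (κ + 4) / 2)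
    rwa [Real.mul_rpow (by positivity) (by positivity), ← Real.rpow_mul hQ,
      ← Real.rpow_mul (by positivity), inv_mul_cancel₀ (by positivity), Real.rpow_one,
      show (1 - ((κ + 4) / 2)⁻¹) * ((κ + 4) / 2) = (κ + 2) / 2 by field_simp; ring] at this
  have h6 : A ^ (κ / 2) ≤ B * Q ^ ((κ + 2) / 2) := by
    have h7 : A ^ ((κ + 4) / 2) = A ^ (κ / 2) * A ^ 2 := by
      rw [← Real.rpow_natCast, ← Real.rpow_add hA]; congr 1; push_cast; ring
    rw [h7] at h5
    refine le_of_mul_le_mul_right ?_ (by positivity : 0 < A ^ 2)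
    linarith
  have h8 := Real.rpow_le_rpow (by positivity) h6 (by positivity : 0 ≤ 1 / κ)
  rw [Real.mul_rpow hB (by positivity), ← Real.rpow_mul hA.le, ← Real.rpow_mul hQ] at h8
  rw [Real.sqrt_eq_rpow]
  convert h8 using 2
  · field_simp
  · congr 1; field_simp

/-! ### A weak Bohnenblust–Hille inequality -/

lemma sum_abs_slice_singleton_le {b : Finset (Fin n) → ℝ} {k : ℕ} (hk : 1 ≤ k) {M : ℝ}
    (hb : ∀ T, #T ≠ k → b T = 0) (hM : ∀ x : Hypercube n, |multilin b (vertex x)| ≤ M)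
    (y : Hypercube n) : ∑ i, |multilin (slice b {i}) (vertex y)| ≤ 3 * (k : ℝ) ^ 2 * M := by
  have h := abs_sum_slice_le hk hb hM (k := 1) (y := vertex y)
    (x := fun i => if 0 ≤ multilin (slice b {i}) (vertex y) then 1 else -1)
    (fun i => by split_ifs <;> simp) (fun i => (abs_vertex y i).le)
  rw [powersetCard_one, sum_map] at h
  refine le_trans (le_of_eq ?_) ((le_abs_self _).trans h)
  refine sum_congr rfl fun i _ => ?_
  simp only [Function.Embedding.coeFn_mk, prod_singleton]
  split_ifs with h0
  · rw [abs_of_nonneg h0, one_mul]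
  · rw [abs_of_neg (not_le.1 h0)]; ring

/-- Littlewood's mixed `(ℓ₁, ℓ₂)` inequality for homogeneous polynomials on the cube: the `ℓ₂` norm
of each partial derivative is compared with its `L₁` norm, and the `L₁` norms are summed by
polarization. -/
lemma sum_sqrt_sum_superset_le {b : Finset (Fin n) → ℝ} {k : ℕ} (hk : 1 ≤ k) {M : ℝ}
    (hb : ∀ T, #T ≠ k → b T = 0) (hM : ∀ x : Hypercube n, |multilin b (vertex x)| ≤ M) :
    ∑ i, √(∑ T with {i} ⊆ T, b T ^ 2) ≤ 3 ^ k * (3 * (k : ℝ) ^ 2 * M) := by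
  have h1 : ∀ i : Fin n, √(∑ T with {i} ⊆ T, b T ^ 2) ≤
      3 ^ k * 𝔼 x : Hypercube n, |multilin (slice b {i}) (vertex x)| := fun i => by
    have h := sqrt_expect_sq_le (κ := 2) two_pos (by positivity)
      (expect_multilin_pow_four_le (a := slice b {i}) (d := k) fun U hU =>
        slice_of_card_ne hb _ _ (by omega))
    rw [expect_multilin_sq, sum_slice_sq] at h
    norm_num at h
    rw [show ((9 : ℝ) ^ k) ^ (1 / 2 : ℝ) = 3 ^ k by
      rw [← Real.sqrt_eq_rpow, show (9 : ℝ) ^ k = (3 ^ k) ^ 2 by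
        rw [← pow_mul, mul_comm, pow_mul]; norm_num]
      exact Real.sqrt_sq (by positivity)] at h
    simpa only [singleton_subset_iff] using h
  calc _ ≤ ∑ i, 3 ^ k * 𝔼 x : Hypercube n, |multilin (slice b {i}) (vertex x)| :=
        sum_le_sum fun i _ => h1 i
    _ = 3 ^ k * 𝔼 x : Hypercube n, ∑ i, |multilin (slice b {i}) (vertex x)| := by
        rw [← mul_sum, expect_sum_comm]
    _ ≤ _ := by
        gcongr
        exact expect_le univ_nonempty fun x _ => sum_abs_slice_singleton_le hk hb hM x

lemma sum_abs_le_sqrt_card_mul {ι : Type*} (s : Finset ι) (f : ι → ℝ) :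
    ∑ i ∈ s, |f i| ≤ √(#s) * √(∑ i ∈ s, f i ^ 2) := by
  rw [← Real.sqrt_mul (Nat.cast_nonneg _)]
  refine Real.le_sqrt_of_sq_le ?_
  simpa using sq_sum_le_card_mul_sum_sq (s := s) (f := fun i => |f i|)

/-- Passing from the mixed `(ℓ₁, ℓ₂)` norm to a weak form of the Bohnenblust–Hille inequality, in
which the exponent `2k / (k + 1)` appears through sums over arbitrary families `A` of `k`-sets.
Sets with an element of low degree in `A` are handled by Cauchy–Schwarz along that element; all
others lie in the small set `H` of elements of high degree, so there are at most `#A / 2` of them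
and induction applies. -/
lemma sum_abs_le_card_rpow {b : Finset (Fin n) → ℝ} {k : ℕ} (hk : 2 ≤ k) {K : ℝ}
    (hK : ∑ i, √(∑ T with {i} ⊆ T, b T ^ 2) ≤ K) (A : Finset (Finset (Fin n)))
    (hA : ∀ T ∈ A, #T = k) :
    ∑ T ∈ A, |b T| ≤ 7 * k * K * (#A : ℝ) ^ (((k : ℝ) - 1) / (2 * k)) := by
  induction hN : #A using Nat.strong_induction_on generalizing A with
  | _ N ih =>
  have hK0 : 0 ≤ K := le_trans (sum_nonneg fun i _ => Real.sqrt_nonneg _) hK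
  have hk2 : (2 : ℝ) ≤ k := by exact_mod_cast hk
  have hk0 : (0 : ℝ) < k := by linarith
  rcases Nat.eq_zero_or_pos N with h0 | hpos
  · rw [card_eq_zero.1 (hN.trans h0), sum_empty]; positivity
  have hN0 : (0 : ℝ) < N := by exact_mod_cast hpos
  set e : ℝ := ((k : ℝ) - 1) / (2 * k) with he
  set deg : Fin n → ℕ := fun i => #{T ∈ A | i ∈ T} with hdeg
  -- The factor `k` makes `#H ≤ N ^ (1 / k)`, as the degrees sum to `k * N`.
  set θ : ℝ := k * (N : ℝ) ^ (((k : ℝ) - 1) / k) with hθ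
  have hθ0 : 0 < θ := by positivity
  set H : Finset (Fin n) := univ.filter fun i => θ < deg i with hH
  set B := A.filter fun T => T ⊆ H with hB
  -- the sets with an element of low degree
  have hgood : ∑ T ∈ A with ¬ T ⊆ H, |b T| ≤ √θ * K := by
    calc ∑ T ∈ A with ¬ T ⊆ H, |b T|
        ≤ ∑ T ∈ A with ¬ T ⊆ H, ∑ i ∈ Hᶜ, if i ∈ T then |b T| else 0 := by
          refine sum_le_sum fun T hT => ?_
          obtain ⟨i, hiT, hiH⟩ := not_subset.1 (mem_filter.1 hT).2
          have := single_le_sum (f := fun i => if i ∈ T then |b T| else 0)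
            (fun i _ => by split_ifs <;> positivity) (mem_compl.2 hiH)
          simpa [hiT] using this
      _ ≤ ∑ T ∈ A, ∑ i ∈ Hᶜ, if i ∈ T then |b T| else 0 :=
          sum_le_sum_of_subset_of_nonneg (filter_subset _ _) fun T _ _ =>
            sum_nonneg fun i _ => by split_ifs <;> positivity
      _ = ∑ i ∈ Hᶜ, ∑ T ∈ A with i ∈ T, |b T| := by
          rw [sum_comm]
          exact sum_congr rfl fun i _ => (sum_filter _ _).symm
      _ ≤ ∑ i ∈ Hᶜ, √θ * √(∑ T with {i} ⊆ T, b T ^ 2) := by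
          refine sum_le_sum fun i hi => (sum_abs_le_sqrt_card_mul _ _).trans ?_
          have hi' : (deg i : ℝ) ≤ θ := by simpa [hH] using hi
          refine mul_le_mul (Real.sqrt_le_sqrt hi') (Real.sqrt_le_sqrt ?_) (Real.sqrt_nonneg _)
            (Real.sqrt_nonneg _)
          refine sum_le_sum_of_subset_of_nonneg (fun T hT => ?_) fun _ _ _ => sq_nonneg _
          simpa using (mem_filter.1 hT).2
      _ ≤ ∑ i, √θ * √(∑ T with {i} ⊆ T, b T ^ 2) :=
          sum_le_sum_of_subset_of_nonneg (subset_univ _) fun _ _ _ => by positivity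
      _ ≤ √θ * K := by rw [← mul_sum]; gcongr
  have hsqrtθ : √θ ≤ k * (N : ℝ) ^ e := by
    have h1 : θ = (√k * (N : ℝ) ^ e) ^ 2 := by
      rw [mul_pow, Real.sq_sqrt hk0.le, ← Real.rpow_natCast ((N : ℝ) ^ e), ← Real.rpow_mul hN0.le,
        hθ, he]
      congr 2; field_simp; norm_num
    rw [h1, Real.sqrt_sq (by positivity)]
    gcongr
    exact Real.sqrt_le_iff.2 ⟨hk0.le, by nlinarith⟩
  -- the sets contained in `H`
  have hHcard : (#H : ℝ) ^ k ≤ N := by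
    have h1 : (#H : ℝ) * θ ≤ k * N := by
      calc (#H : ℝ) * θ = ∑ i ∈ H, θ := by rw [sum_const, nsmul_eq_mul]
        _ ≤ ∑ i ∈ H, (deg i : ℝ) := sum_le_sum fun i hi => (mem_filter.1 hi).2.le
        _ ≤ ∑ i, (deg i : ℝ) :=
            sum_le_sum_of_subset_of_nonneg (subset_univ _) fun _ _ _ => Nat.cast_nonneg _
        _ = ∑ T ∈ A, (#T : ℝ) := by
            have : ∑ i, deg i = ∑ T ∈ A, #T := by
              simp only [hdeg, card_filter]
              rw [sum_comm]
              refine sum_congr rfl fun T _ => ?_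
              rw [← card_filter]; simp
            exact_mod_cast this
        _ = k * N := by
            rw [sum_congr rfl fun T hT => by rw [hA T hT], sum_const, hN, nsmul_eq_mul, mul_comm]
    have h2 : (#H : ℝ) ≤ (N : ℝ) ^ (1 / k : ℝ) := by
      have h3 : (N : ℝ) = (N : ℝ) ^ (1 / k : ℝ) * (N : ℝ) ^ (((k : ℝ) - 1) / k) := by
        rw [← Real.rpow_add hN0]
        conv_lhs => rw [← Real.rpow_one (N : ℝ)]
        congr 1; field_simp; ring
      have h4 : (#H : ℝ) * (N : ℝ) ^ (((k : ℝ) - 1) / k) ≤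
          (N : ℝ) ^ (1 / k : ℝ) * (N : ℝ) ^ (((k : ℝ) - 1) / k) := by
        rw [← h3]
        refine le_of_mul_le_mul_left ?_ hk0
        calc _ = (#H : ℝ) * θ := by rw [hθ]; ring
          _ ≤ _ := h1
      exact le_of_mul_le_mul_right h4 (by positivity)
    calc (#H : ℝ) ^ k ≤ ((N : ℝ) ^ (1 / k : ℝ)) ^ k := by gcongr
      _ = N := by
        rw [← Real.rpow_natCast, ← Real.rpow_mul hN0.le, one_div, inv_mul_cancel₀ hk0.ne',
          Real.rpow_one]
  have hBcard : (#B : ℝ) ≤ N / 2 := by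
    have h1 : #B ≤ (#H).choose k := by
      rw [← card_powersetCard]
      refine card_le_card fun T hT => ?_
      obtain ⟨hT1, hT2⟩ := mem_filter.1 hT
      exact mem_powersetCard.2 ⟨hT2, hA T hT1⟩
    have h2 : (2 : ℝ) ≤ k.factorial := by
      exact_mod_cast (Nat.factorial_le hk : Nat.factorial 2 ≤ k.factorial)
    calc (#B : ℝ) ≤ (#H).choose k := by exact_mod_cast h1
      _ ≤ (#H : ℝ) ^ k / k.factorial := Nat.choose_le_pow_div _ _
      _ ≤ N / 2 := by gcongr
  have hbad : ∑ T ∈ B, |b T| ≤ 7 * k * K * (0.85 * (N : ℝ) ^ e) := by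
    have hlt : #B < N := by
      have : (#B : ℝ) < N := by linarith
      exact_mod_cast this
    refine (ih _ hlt B (fun T hT => hA T (mem_filter.1 hT).1) rfl).trans ?_
    gcongr
    have he4 : (1 / 4 : ℝ) ≤ e := by
      rw [he, div_le_div_iff₀ (by norm_num) (by positivity)]; linarith
    -- Halving the family gains a fixed factor `0.85`, which leaves room for the term `√θ * K`.
    have hhalf : (1 / 2 : ℝ) ^ e ≤ 0.85 := by
      calc (1 / 2 : ℝ) ^ e ≤ (1 / 2 : ℝ) ^ (1 / 4 : ℝ) :=
            Real.rpow_le_rpow_of_exponent_ge (by norm_num) (by norm_num) he4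
        _ ≤ (0.85 ^ 4 : ℝ) ^ (1 / 4 : ℝ) := by
            refine Real.rpow_le_rpow ?_ ?_ ?_ <;> norm_num
        _ = 0.85 := by
            rw [← Real.rpow_natCast, ← Real.rpow_mul (by norm_num)]; norm_num
    calc (#B : ℝ) ^ e ≤ (1 / 2 * N) ^ e := by
          refine Real.rpow_le_rpow (Nat.cast_nonneg _) (by linarith) (by linarith)
      _ = (1 / 2 : ℝ) ^ e * (N : ℝ) ^ e := Real.mul_rpow (by norm_num) hN0.le
      _ ≤ _ := by gcongr
  rw [← sum_filter_add_sum_filter_not A fun T => T ⊆ H]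
  have hNe : 0 ≤ k * K * (N : ℝ) ^ e := by positivity
  have hg2 : √θ * K ≤ k * (N : ℝ) ^ e * K := by gcongr
  linarith

/-- A weak-type bound implies a strong-type bound for a smaller exponent, without loss in the power
of the number of terms: remove the smallest term and induct. -/
lemma sum_rpow_le_of_forall_sum_le {ι : Type*} [DecidableEq ι] {c : ι → ℝ} (hc : ∀ i, 0 ≤ c i)
    {K κ : ℝ} (hκ : 1 ≤ κ) (hK : 0 ≤ K) (A : Finset ι)
    (hA : ∀ B ⊆ A, ∑ i ∈ B, c i ≤ K * (#B : ℝ) ^ ((κ - 1) / (2 * κ))) :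
    ∑ i ∈ A, c i ^ (2 * κ / (κ + 2)) ≤
      (κ + 2) * K ^ (2 * κ / (κ + 2)) * (#A : ℝ) ^ (1 / (κ + 2)) := by
  have hκ0 : 0 < κ := by linarith
  induction hN : #A generalizing A with
  | zero =>
    rw [card_eq_zero.1 hN, sum_empty]; positivity
  | succ N ih =>
    have hne : A.Nonempty := card_pos.1 (by omega)
    obtain ⟨i, hi, hmin⟩ := exists_min_image A c hne
    have hN1 : (0 : ℝ) < (N + 1 : ℕ) := by positivity
    set X : ℝ := ((N + 1 : ℕ) : ℝ) with hX
    have h1 : c i ≤ K * X ^ (-((κ + 1) / (2 * κ))) := by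
      have h2 : X * c i ≤ K * X ^ ((κ - 1) / (2 * κ)) := by
        have h3 := card_nsmul_le_sum A c (c i) hmin
        rw [hN, nsmul_eq_mul] at h3
        have h4 := hA A subset_rfl
        rw [hN] at h4
        exact h3.trans h4
      have h5 : X ^ ((κ - 1) / (2 * κ)) = X ^ (-((κ + 1) / (2 * κ))) * X := by
        rw [← Real.rpow_add_one hN1.ne']; congr 1; field_simp; ring
      rw [h5] at h2
      refine le_of_mul_le_mul_left ?_ hN1
      linarith
    have h6 : c i ^ (2 * κ / (κ + 2)) ≤ K ^ (2 * κ / (κ + 2)) * X ^ (1 / (κ + 2) - 1) := by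
      calc c i ^ (2 * κ / (κ + 2)) ≤ (K * X ^ (-((κ + 1) / (2 * κ)))) ^ (2 * κ / (κ + 2)) :=
            Real.rpow_le_rpow (hc i) h1 (by positivity)
        _ = _ := by
            rw [Real.mul_rpow hK (by positivity), ← Real.rpow_mul hN1.le]
            congr 2; field_simp; ring
    have h7 := ih (A.erase i) (fun B hB => hA B (hB.trans (erase_subset _ _)))
      (by rw [card_erase_of_mem hi, hN]; rfl)
    have h8 : (N : ℝ) ^ (1 / (κ + 2)) ≤
        X ^ (1 / (κ + 2)) - 1 / (κ + 2) * X ^ (1 / (κ + 2) - 1) := by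
      have h9 : (N : ℝ) = X * (1 + -(1 / X)) := by
        have : X = N + 1 := by rw [hX]; push_cast; ring
        field_simp; linarith
      have h10 : (1 : ℝ) / X ≤ 1 := by
        rw [div_le_one hN1, hX]; push_cast; linarith [Nat.cast_nonneg (α := ℝ) N]
      have h11 := rpow_one_add_le_one_add_mul_self (s := -(1 / X)) (by linarith)
        (p := 1 / (κ + 2)) (by positivity) (by rw [div_le_one (by linarith)]; linarith)
      rw [h9, Real.mul_rpow hN1.le (by linarith)]
      calc _ ≤ X ^ (1 / (κ + 2)) * (1 + 1 / (κ + 2) * -(1 / X)) := by gcongr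
        _ = _ := by rw [Real.rpow_sub_one hN1.ne']; ring
    rw [← add_sum_erase A _ hi]
    calc _ ≤ K ^ (2 * κ / (κ + 2)) * X ^ (1 / (κ + 2) - 1) +
          (κ + 2) * K ^ (2 * κ / (κ + 2)) *
            (X ^ (1 / (κ + 2)) - 1 / (κ + 2) * X ^ (1 / (κ + 2) - 1)) := by
          refine add_le_add h6 (h7.trans ?_)
          gcongr
      _ = _ := by field_simp; ring

/-! ### Coefficient sums through mixed norms -/

/-- A mixed-norm Bohnenblust–Hille estimate with `k` free indices. For fixed `y` the derivatives
`∂_T P (y)`, `#T = k`, are the coefficients of a `k`-homogeneous polynomial, to which the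
weak-type inequality applies; the passage from `L₂(y)` to `L_q(y)` with `q = 2k / (k + 2)` costs
only `9 ^ (m / k)`. -/
lemma sum_sqrt_sum_superset_card_le {a : Finset (Fin n) → ℝ} {m k : ℕ} (hk : 2 ≤ k) (hkm : k ≤ m)
    {M : ℝ} (ha : ∀ S, #S ≠ m → a S = 0) (hM : ∀ x : Hypercube n, |multilin a (vertex x)| ≤ M) :
    ∑ T ∈ powersetCard k univ, √(∑ S with T ⊆ S, a S ^ 2) ≤
      ((9 : ℝ) ^ m) ^ (1 / k : ℝ) *
        ((k + 2) * (7 * k * (3 ^ k * (3 * (k : ℝ) ^ 2 * (3 * (m : ℝ) ^ (2 * k) * M))))) *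
        (n.choose k : ℝ) ^ (((k : ℝ) - 1) / (2 * k)) := by
  have hk2 : (2 : ℝ) ≤ k := by exact_mod_cast hk
  have hk0 : (0 : ℝ) < k := by linarith
  have hM0 : 0 ≤ M := (abs_nonneg _).trans (hM 1)
  set K : ℝ := 7 * k * (3 ^ k * (3 * (k : ℝ) ^ 2 * (3 * (m : ℝ) ^ (2 * k) * M))) with hK
  have hK0 : 0 ≤ K := by positivity
  set q : ℝ := 2 * k / (k + 2) with hq
  have hq1 : 1 ≤ q := by rw [hq, le_div_iff₀ (by linarith)]; linarith
  have hq0 : 0 < q := by linarith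
  set N : ℝ := ((n.choose k : ℕ) : ℝ) with hN
  have hN0 : 0 ≤ N := Nat.cast_nonneg _
  have hcard : (#(powersetCard k (univ : Finset (Fin n))) : ℝ) = N := by simp [hN]
  -- the pointwise bound for the derivatives of order `k`
  have hpt : ∀ y : Hypercube n,
      ∑ T ∈ powersetCard k univ, |multilin (slice a T) (vertex y)| ^ q ≤
        (k + 2) * K ^ q * N ^ (1 / ((k : ℝ) + 2)) := by
    intro y
    set b : Finset (Fin n) → ℝ := fun T => if #T = k then multilin (slice a T) (vertex y) else 0
      with hb
    have hbhom : ∀ T, #T ≠ k → b T = 0 := fun T hT => if_neg hT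
    have hbM : ∀ x : Hypercube n, |multilin b (vertex x)| ≤ 3 * (m : ℝ) ^ (2 * k) * M := by
      intro x
      have h := abs_sum_slice_le (by omega) ha hM (x := vertex x) (y := vertex y)
        (fun i => (abs_vertex x i).le) (fun i => (abs_vertex y i).le) k
      rw [powersetCard_eq_filter, powerset_univ, sum_filter] at h
      refine le_trans (le_of_eq ?_) h
      congr 1
      refine sum_congr rfl fun T _ => ?_
      simp only [hb]
      split_ifs
      · ring
      · ring
    have hmix := sum_sqrt_sum_superset_le (by omega) hbhom hbM
    have h := sum_rpow_le_of_forall_sum_le (c := fun T => |b T|) (fun T => abs_nonneg _)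
      (K := K) (κ := k) (by linarith) hK0 (powersetCard k univ) fun B hB =>
        sum_abs_le_card_rpow hk hmix B fun T hT => (mem_powersetCard.1 (hB hT)).2
    rw [hcard] at h
    refine le_trans (le_of_eq ?_) h
    refine sum_congr rfl fun T hT => ?_
    simp only [hb, if_pos (mem_powersetCard.1 hT).2, hq]
  -- the comparison of moments, for each derivative
  set u : Finset (Fin n) → ℝ :=
    fun T => (𝔼 y : Hypercube n, |multilin (slice a T) (vertex y)| ^ q) ^ (1 / q) with hu
  have hE0 : ∀ T, 0 ≤ 𝔼 y : Hypercube n, |multilin (slice a T) (vertex y)| ^ q := fun T =>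
    expect_nonneg fun y _ => by positivity
  have hu0 : ∀ T, 0 ≤ u T := fun T => Real.rpow_nonneg (hE0 T) _
  have hcomp : ∀ T : Finset (Fin n), √(∑ S with T ⊆ S, a S ^ 2) ≤
      ((9 : ℝ) ^ m) ^ (1 / k : ℝ) * u T := fun T => by
    have h := sqrt_expect_sq_le (κ := k) hk0 (by positivity)
      (expect_multilin_pow_four_le (a := slice a T) (d := m) fun U hU =>
        slice_of_card_ne ha _ _ (by omega))
    rw [expect_multilin_sq, sum_slice_sq] at h
    rwa [show ((k : ℝ) + 2) / (2 * k) = 1 / q by rw [hq, one_div_div]] at h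
  have hsum : ∑ T ∈ powersetCard k univ, u T ≤
      (k + 2) * K * N ^ (((k : ℝ) - 1) / (2 * k)) := by
    have h1 := Real.rpow_sum_le_const_mul_sum_rpow_of_nonneg (powersetCard k univ) hq1
      (f := u) fun T _ => hu0 T
    have h2 : ∑ T ∈ powersetCard k univ, u T ^ q ≤
        (k + 2) * K ^ q * N ^ (1 / ((k : ℝ) + 2)) := by
      have h3 : ∀ T, u T ^ q =
          𝔼 y : Hypercube n, |multilin (slice a T) (vertex y)| ^ q := fun T => by
        simp only [hu]
        rw [← Real.rpow_mul (hE0 T), one_div, inv_mul_cancel₀ hq0.ne', Real.rpow_one]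
      simp only [h3]
      rw [← expect_sum_comm]
      exact expect_le univ_nonempty fun y _ => hpt y
    rw [hcard] at h1
    have h4 := h1.trans (mul_le_mul_of_nonneg_left h2 (by positivity))
    have h5 := Real.rpow_le_rpow (Real.rpow_nonneg (sum_nonneg fun T _ => hu0 T) _) h4
      (by positivity : 0 ≤ 1 / q)
    rw [← Real.rpow_mul (sum_nonneg fun T _ => hu0 T), mul_one_div_cancel hq0.ne',
      Real.rpow_one] at h5
    refine h5.trans ?_
    rw [Real.mul_rpow (by positivity) (by positivity),
      Real.mul_rpow (by positivity) (by positivity),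
      Real.mul_rpow (by positivity) (by positivity), ← Real.rpow_mul hN0, ← Real.rpow_mul hK0,
      ← Real.rpow_mul hN0, mul_one_div_cancel hq0.ne', Real.rpow_one]
    have h6 : ((k : ℝ) + 2) ^ (1 / q) ≤ k + 2 := by
      conv_rhs => rw [← Real.rpow_one ((k : ℝ) + 2)]
      refine Real.rpow_le_rpow_of_exponent_le (by linarith) ?_
      rw [div_le_one hq0]; exact hq1
    have hkk : (0 : ℝ) < k + 2 := by linarith
    have h7 : N ^ ((q - 1) * (1 / q)) * N ^ (1 / ((k : ℝ) + 2) * (1 / q)) =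
        N ^ (((k : ℝ) - 1) / (2 * k)) := by
      rw [← Real.rpow_add_of_nonneg hN0
        (mul_nonneg (by linarith) (by positivity)) (by positivity)]
      congr 1
      rw [hq]; field_simp; ring
    calc N ^ ((q - 1) * (1 / q)) * (((k : ℝ) + 2) ^ (1 / q) * K *
          N ^ (1 / ((k : ℝ) + 2) * (1 / q)))
        = ((k : ℝ) + 2) ^ (1 / q) * K * (N ^ ((q - 1) * (1 / q)) *
          N ^ (1 / ((k : ℝ) + 2) * (1 / q))) := by ring
      _ ≤ _ := by rw [h7]; gcongr
  calc _ ≤ ∑ T ∈ powersetCard k univ, ((9 : ℝ) ^ m) ^ (1 / k : ℝ) * u T :=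
        sum_le_sum fun T _ => hcomp T
    _ ≤ ((9 : ℝ) ^ m) ^ (1 / k : ℝ) * ((k + 2) * K * N ^ (((k : ℝ) - 1) / (2 * k))) := by
        rw [← mul_sum]; gcongr
    _ = _ := by ring

lemma card_superset_powersetCard {T : Finset (Fin n)} {m k : ℕ} (hT : #T = k) (hkm : k ≤ m) :
    #{S ∈ powersetCard m (univ : Finset (Fin n)) | T ⊆ S} = (n - k).choose (m - k) := by
  have h : #(powersetCard (m - k) (univ \ T)) = (n - k).choose (m - k) := by
    rw [card_powersetCard, card_sdiff_of_subset (subset_univ _), card_univ, Fintype.card_fin, hT]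
  rw [← h]
  refine card_nbij' (fun S => S \ T) (fun U => U ∪ T) ?_ ?_ ?_ ?_
  · intro S hS
    obtain ⟨hS1, hS2⟩ := mem_filter.1 hS
    refine mem_coe.2 (mem_powersetCard.2 ⟨sdiff_subset_sdiff (subset_univ _) subset_rfl, ?_⟩)
    rw [card_sdiff_of_subset hS2, (mem_powersetCard.1 hS1).2, hT]
  · intro U hU
    obtain ⟨hU1, hU2⟩ := mem_powersetCard.1 hU
    refine mem_coe.2 (mem_filter.2 ⟨mem_powersetCard.2 ⟨subset_univ _, ?_⟩, subset_union_right⟩)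
    rw [card_union_of_disjoint (disjoint_of_subset_left hU1 sdiff_disjoint), hU2, hT]; omega
  · intro S hS
    exact sdiff_union_of_subset (mem_filter.1 hS).2
  · intro U hU
    obtain ⟨hU1, _⟩ := mem_powersetCard.1 hU
    exact union_sdiff_cancel_right (disjoint_of_subset_left hU1 sdiff_disjoint)

/-- Double counting of pairs `T ⊆ S` and Cauchy–Schwarz over `S`. -/
lemma choose_mul_sum_abs_le (a : Finset (Fin n) → ℝ) {m k : ℕ} (hkm : k ≤ m) :
    (m.choose k : ℝ) * ∑ S ∈ powersetCard m univ, |a S| ≤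
      √((n - k).choose (m - k) : ℝ) *
        ∑ T ∈ powersetCard k univ, √(∑ S with T ⊆ S, a S ^ 2) := by
  calc (m.choose k : ℝ) * ∑ S ∈ powersetCard m univ, |a S|
      = ∑ S ∈ powersetCard m univ, ∑ T ∈ powersetCard k S, |a S| := by
        rw [mul_sum]
        refine sum_congr rfl fun S hS => ?_
        rw [sum_const, card_powersetCard, (mem_powersetCard.1 hS).2, nsmul_eq_mul]
    _ = ∑ T ∈ powersetCard k univ, ∑ S ∈ powersetCard m univ with T ⊆ S, |a S| := by
        refine sum_comm' fun S T => ?_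
        simp only [mem_powersetCard, mem_filter, subset_univ, true_and]
        tauto
    _ ≤ ∑ T ∈ powersetCard k univ,
          √((n - k).choose (m - k) : ℝ) * √(∑ S with T ⊆ S, a S ^ 2) := by
        refine sum_le_sum fun T hT => (sum_abs_le_sqrt_card_mul _ _).trans ?_
        rw [card_superset_powersetCard (mem_powersetCard.1 hT).2 hkm]
        gcongr
        exact subset_univ _
    _ = _ := by rw [mul_sum]

/-- The quantity `binom(n, m) ^ (1 / m)` is nonincreasing in `m`. -/
lemma choose_pow_le_choose_pow {k m : ℕ} (hk : 1 ≤ k) (hkm : k ≤ m) :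
    n.choose m ^ k ≤ n.choose k ^ m := by
  induction m, hkm using Nat.le_induction with
  | base => exact le_rfl
  | succ m hkm ih =>
    rcases Nat.lt_or_ge n (m + 1) with h | h
    · rw [Nat.choose_eq_zero_of_lt h, zero_pow (by omega)]; exact Nat.zero_le _
    have h1 : n.choose (m + 1) ^ m ≤ n.choose m ^ (m + 1) := by
      have h2 : (n - m) ^ m ≤ n.choose m * (m + 1) ^ m := by
        have h3 : (n + 1 - m) ^ m ≤ m.factorial * n.choose m := by
          rw [← Nat.descFactorial_eq_factorial_mul_choose]
          exact n.pow_sub_le_descFactorial m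
        calc (n - m) ^ m ≤ (n + 1 - m) ^ m := Nat.pow_le_pow_left (by omega) m
          _ ≤ m.factorial * n.choose m := h3
          _ ≤ (m + 1) ^ m * n.choose m := by
            gcongr
            exact (Nat.factorial_le_pow m).trans (Nat.pow_le_pow_left (by omega) m)
          _ = _ := mul_comm _ _
      refine Nat.le_of_mul_le_mul_right ?_ (by positivity : 0 < (m + 1) ^ m)
      calc n.choose (m + 1) ^ m * (m + 1) ^ m = n.choose m ^ m * (n - m) ^ m := by
            rw [← mul_pow, ← mul_pow, Nat.choose_succ_right_eq]
        _ ≤ n.choose m ^ m * (n.choose m * (m + 1) ^ m) := by gcongr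
        _ = _ := by ring
    refine (Nat.pow_le_pow_iff_left (by omega : m ≠ 0)).1 ?_
    calc (n.choose (m + 1) ^ k) ^ m = (n.choose (m + 1) ^ m) ^ k := by
          rw [← pow_mul, ← pow_mul, mul_comm]
      _ ≤ (n.choose m ^ (m + 1)) ^ k := by gcongr
      _ = (n.choose m ^ k) ^ (m + 1) := by rw [← pow_mul, ← pow_mul, mul_comm]
      _ ≤ (n.choose k ^ m) ^ (m + 1) := by gcongr
      _ = _ := by rw [← pow_mul, ← pow_mul, mul_comm]

/-- With `binom(n, m) binom(m, k) = binom(n, k) binom(n - k, m - k)`, the exponents of the binomial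
coefficients match up to the monotonicity of `binom(n, m) ^ (1 / m)`. -/
lemma sqrt_choose_mul_le {k m : ℕ} (hk : 1 ≤ k) (hkm : k ≤ m) (hmn : m ≤ n) :
    √((n - k).choose (m - k) : ℝ) * (n.choose k : ℝ) ^ (((k : ℝ) - 1) / (2 * k)) ≤
      m.choose k * (n.choose m : ℝ) ^ (((m : ℝ) - 1) / (2 * m)) := by
  have hk0 : (0 : ℝ) < k := by exact_mod_cast hk
  have hm0 : (0 : ℝ) < m := by exact_mod_cast (by omega : 0 < m)
  have hP : (0 : ℝ) < n.choose m := by exact_mod_cast Nat.choose_pos hmn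
  have hN : (0 : ℝ) < n.choose k := by exact_mod_cast Nat.choose_pos (hkm.trans hmn)
  have hQ : (1 : ℝ) ≤ m.choose k := by exact_mod_cast Nat.choose_pos hkm
  have hR : (0 : ℝ) ≤ (n - k).choose (m - k) := Nat.cast_nonneg _
  have hPQ : (n.choose m : ℝ) * m.choose k = n.choose k * (n - k).choose (m - k) := by
    exact_mod_cast Nat.choose_mul hkm
  have hroot : (n.choose m : ℝ) ^ (1 / (2 * m) : ℝ) ≤ (n.choose k : ℝ) ^ (1 / (2 * k) : ℝ) := by
    have h1 : ((n.choose m : ℝ)) ^ k ≤ (n.choose k : ℝ) ^ m := by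
      exact_mod_cast choose_pow_le_choose_pow (n := n) hk hkm
    have h2 := Real.rpow_le_rpow (by positivity) h1 (by positivity : 0 ≤ 1 / (2 * k * m : ℝ))
    rw [← Real.rpow_natCast, ← Real.rpow_natCast, ← Real.rpow_mul hP.le,
      ← Real.rpow_mul hN.le] at h2
    convert h2 using 2 <;> field_simp
  have e1 : (n.choose k : ℝ) ^ (((k : ℝ) - 1) / (2 * k)) =
      √(n.choose k : ℝ) / (n.choose k : ℝ) ^ (1 / (2 * k) : ℝ) := by
    rw [Real.sqrt_eq_rpow, ← Real.rpow_sub hN]; congr 1; field_simp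
  have e2 : (n.choose m : ℝ) ^ (((m : ℝ) - 1) / (2 * m)) =
      √(n.choose m : ℝ) / (n.choose m : ℝ) ^ (1 / (2 * m) : ℝ) := by
    rw [Real.sqrt_eq_rpow, ← Real.rpow_sub hP]; congr 1; field_simp
  rw [e1, e2, ← mul_div_assoc, ← mul_div_assoc]
  refine div_le_div₀ (by positivity) ?_ (by positivity) hroot
  rw [← Real.sqrt_mul hR, mul_comm ((n - k).choose (m - k) : ℝ), ← hPQ, Real.sqrt_mul hP.le,
    mul_comm]
  gcongr
  exact Real.sqrt_le_iff.2 ⟨by linarith, by nlinarith⟩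

/-- The coefficient sum of an `m`-homogeneous polynomial, for a free parameter `k`. -/
lemma sum_abs_coeff_le {a : Finset (Fin n) → ℝ} {m k : ℕ} (hk : 2 ≤ k) (hkm : k ≤ m) (hmn : m ≤ n)
    {M : ℝ} (ha : ∀ S, #S ≠ m → a S = 0) (hM : ∀ x : Hypercube n, |multilin a (vertex x)| ≤ M) :
    ∑ S ∈ powersetCard m univ, |a S| ≤
      (n.choose m : ℝ) ^ (((m : ℝ) - 1) / (2 * m)) * (((9 : ℝ) ^ m) ^ (1 / k : ℝ) *
        ((k + 2) * (7 * k * (3 ^ k * (3 * (k : ℝ) ^ 2 * (3 * (m : ℝ) ^ (2 * k) * M)))))) := by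
  have hM0 : 0 ≤ M := (abs_nonneg _).trans (hM 1)
  have hQ : (0 : ℝ) < m.choose k := by exact_mod_cast Nat.choose_pos hkm
  set D : ℝ := ((9 : ℝ) ^ m) ^ (1 / k : ℝ) *
    ((k + 2) * (7 * k * (3 ^ k * (3 * (k : ℝ) ^ 2 * (3 * (m : ℝ) ^ (2 * k) * M)))))
  have hD : 0 ≤ D := by positivity
  refine le_of_mul_le_mul_left ?_ hQ
  calc (m.choose k : ℝ) * ∑ S ∈ powersetCard m univ, |a S|
      ≤ √((n - k).choose (m - k) : ℝ) *
        ∑ T ∈ powersetCard k univ, √(∑ S with T ⊆ S, a S ^ 2) := choose_mul_sum_abs_le a hkm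
    _ ≤ √((n - k).choose (m - k) : ℝ) * (D * (n.choose k : ℝ) ^ (((k : ℝ) - 1) / (2 * k))) := by
        gcongr
        exact sum_sqrt_sum_superset_card_le hk hkm ha hM
    _ = (√((n - k).choose (m - k) : ℝ) * (n.choose k : ℝ) ^ (((k : ℝ) - 1) / (2 * k))) * D := by
        ring
    _ ≤ (m.choose k * (n.choose m : ℝ) ^ (((m : ℝ) - 1) / (2 * m))) * D := by
        exact mul_le_mul_of_nonneg_right (sqrt_choose_mul_le (by omega) hkm hmn) hD
    _ = _ := by ring

/-- The choice `k ≈ √(m / log m)` balances the two sources of loss `9 ^ (m / k)` and `m ^ O(k)`. -/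
lemma exists_free_index_count {m : ℕ} (hm : 2 ≤ m) : ∃ k : ℕ, 2 ≤ k ∧ k ≤ m ∧
    ((9 : ℝ) ^ m) ^ (1 / k : ℝ) *
      ((k + 2) * (7 * k * (3 ^ k * (3 * (k : ℝ) ^ 2 * (3 * (m : ℝ) ^ (2 * k)))))) ≤
      Real.exp (23 * √(m * Real.log m)) := by
  have hm2 : (2 : ℝ) ≤ m := by exact_mod_cast hm
  have hm0 : (0 : ℝ) < m := by linarith
  set L := Real.log m with hL
  have hL2 : (0.69 : ℝ) < L := by
    have := Real.log_le_log two_pos hm2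
    linarith [Real.log_two_gt_d9]
  have hL0 : 0 < L := by linarith
  have hLm : L ≤ m - 1 := Real.log_le_sub_one_of_pos hm0
  set x := √(m / L) with hx
  have hx1 : 1 < x := by
    rw [hx, Real.lt_sqrt (by norm_num), one_pow, one_lt_div hL0]; linarith
  have hxsq : x ^ 2 * L = m := by
    rw [hx, Real.sq_sqrt (by positivity)]; field_simp
  have hxL : √(m * L) = x * L := by
    rw [← hxsq, show x ^ 2 * L * L = (x * L) ^ 2 by ring]
    exact Real.sqrt_sq (by positivity)
  have hxm : x ≤ m := by nlinarith
  set k := ⌈x⌉₊ with hk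
  have hk2 : 2 ≤ k := Nat.lt_ceil.2 (by exact_mod_cast hx1)
  have hkm : k ≤ m := Nat.ceil_le.2 hxm
  have hkx : x ≤ k := Nat.le_ceil x
  have hkx2 : (k : ℝ) ≤ 2 * x := by linarith [Nat.ceil_lt_add_one (by linarith : 0 ≤ x)]
  have hk0 : (0 : ℝ) < k := by linarith
  have hkm' : (k : ℝ) ≤ m := by exact_mod_cast hkm
  refine ⟨k, hk2, hkm, ?_⟩
  have h1 : ((9 : ℝ) ^ m) ^ (1 / k : ℝ) ≤ Real.exp (3 * (x * L)) := by
    have h9 : (9 : ℝ) ≤ Real.exp 3 := by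
      have := Real.exp_one_gt_d9
      calc (9 : ℝ) ≤ 2.7 ^ 3 := by norm_num
        _ ≤ Real.exp 1 ^ 3 := by gcongr; linarith
        _ = Real.exp 3 := by rw [← Real.exp_nat_mul]; norm_num
    calc ((9 : ℝ) ^ m) ^ (1 / k : ℝ) ≤ (Real.exp 3 ^ m) ^ (1 / k : ℝ) := by gcongr
      _ = Real.exp (3 * (m / k)) := by
        rw [← Real.exp_nat_mul, ← Real.exp_mul]; congr 1; field_simp
      _ ≤ _ := by
        gcongr
        rw [div_le_iff₀ hk0]
        nlinarith [mul_le_mul_of_nonneg_left hkx (by positivity : 0 ≤ x * L)]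
  have h2 : ((k : ℝ) + 2) * (7 * k * (3 ^ k * (3 * (k : ℝ) ^ 2 * (3 * (m : ℝ) ^ (2 * k))))) ≤
      (m : ℝ) ^ (10 * k) := by
    have h4 : (4 : ℝ) ≤ (m : ℝ) ^ 2 := by nlinarith
    have hA : (k : ℝ) + 2 ≤ m ^ 2 := by nlinarith
    have hB : 7 * (k : ℝ) ≤ m ^ 4 := by nlinarith
    have hC : (3 : ℝ) ^ k ≤ m ^ (2 * k) := by
      rw [pow_mul]; gcongr; linarith
    have hD : 3 * (k : ℝ) ^ 2 ≤ m ^ 4 := by nlinarith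
    calc _ ≤ (m : ℝ) ^ 2 * (m ^ 4 * (m ^ (2 * k) * (m ^ 4 * (m ^ 2 * m ^ (2 * k))))) := by
          gcongr
          linarith
      _ = (m : ℝ) ^ (12 + 4 * k) := by ring
      _ ≤ _ := pow_le_pow_right₀ (by linarith) (by omega)
  have h3 : (m : ℝ) ^ (10 * k) ≤ Real.exp (20 * (x * L)) := by
    have h4 : (m : ℝ) ^ (10 * k) = Real.exp ((10 * k : ℕ) * L) := by
      rw [Real.exp_nat_mul, hL, Real.exp_log hm0]
    rw [h4]
    refine Real.exp_le_exp.2 ?_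
    push_cast
    nlinarith
  calc _ ≤ Real.exp (3 * (x * L)) * Real.exp (20 * (x * L)) := by
        gcongr
        exact h2.trans h3
    _ = _ := by rw [← Real.exp_add, hxL]; congr 1; ring

/-! ### The Khinchine–Kahane inequality and multilinear forms -/

lemma walsh_flip (i : Fin n) (S : Finset (Fin n)) (x : Hypercube n) :
    walsh S (x * Pi.mulSingle i (-1)) = (1 - 2 * if i ∈ S then 1 else 0) * walsh S x := by
  split_ifs with h
  · rw [walsh_eq, walsh_eq, ← mul_prod_erase S _ h, ← mul_prod_erase S (vertex x) h,
      vertex_mul_flip, if_pos rfl, prod_congr rfl fun j hj => by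
        rw [vertex_mul_flip, if_neg (ne_of_mem_erase hj)]]
    ring
  · rw [walsh_mul_flip h]; ring

lemma sum_flip (F : Hypercube n → ℝ) (x : Hypercube n) :
    ∑ i, F (x * Pi.mulSingle i (-1)) =
      multilin (fun S => ((n : ℝ) - 2 * #S) * walshCoeff F S) (vertex x) := by
  have h : ∀ i, F (x * Pi.mulSingle i (-1)) =
      ∑ S, (1 - 2 * if i ∈ S then 1 else 0) * (walshCoeff F S * walsh S x) := fun i => by
    rw [← multilin_walshCoeff F (x * Pi.mulSingle i (-1)), multilin]
    refine sum_congr rfl fun S _ => ?_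
    rw [← walsh_eq, walsh_flip]; ring
  simp_rw [h]
  rw [sum_comm]
  refine sum_congr rfl fun S _ => ?_
  rw [← sum_mul, ← walsh_eq, sum_sub_distrib, ← mul_sum]
  simp; ring

/-- The spectrum of an even function is supported on sets of even size. -/
lemma walshCoeff_eq_zero_of_even {F : Hypercube n → ℝ} (hF : ∀ x, F (-x) = F x)
    {S : Finset (Fin n)} (hS : Odd #S) : walshCoeff F S = 0 := by
  have h1 : ∀ x : Hypercube n, walsh S (-x) = -walsh S x := fun x => by
    have : ∀ i, vertex (-x) i = -1 * vertex x i := fun i => by simp [vertex]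
    rw [walsh_eq, prod_congr rfl fun i _ => this i, prod_mul_distrib, prod_const, hS.neg_one_pow,
      walsh_eq]
    ring
  have h2 : ∑ y, F y * walsh S y = ∑ y, -(F y * walsh S y) := by
    refine Fintype.sum_equiv (Equiv.neg _) _ _ fun y => ?_
    rw [Equiv.neg_apply, hF, h1]; ring
  rw [sum_neg_distrib] at h2
  rw [walshCoeff, show ∑ y, F y * walsh S y = 0 by linarith, mul_zero]

/-- The Khinchine–Kahane inequality with the sharp constant `√2`. The function
`F x = ‖∑ x_i v_i‖` is even, so its Fourier spectrum avoids level one and Poincaré's inequality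
improves by a factor of two; the triangle inequality bounds its Dirichlet form by its second
moment. -/
theorem sqrt_sum_norm_sq_le {E : Type*} [NormedAddCommGroup E] [InnerProductSpace ℝ E]
    (v : Fin n → E) :
    √(∑ i, ‖v i‖ ^ 2) ≤ √2 * 𝔼 x : Hypercube n, ‖∑ i, vertex x i • v i‖ := by
  set s : Hypercube n → E := fun x => ∑ i, vertex x i • v i with hs
  set F : Hypercube n → ℝ := fun x => ‖s x‖ with hF
  set a := walshCoeff F with ha
  have hFa : ∀ x, multilin a (vertex x) = F x := multilin_walshCoeff F
  have hmom : 𝔼 x, F x ^ 2 = ∑ i, ‖v i‖ ^ 2 := by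
    have h1 : ∀ x, F x ^ 2 = ∑ i, ∑ j, inner ℝ (v i) (v j) * (walsh {i} x * walsh {j} x) := by
      intro x
      simp only [hF, hs]
      rw [← real_inner_self_eq_norm_sq, sum_inner]
      refine sum_congr rfl fun i _ => ?_
      rw [inner_sum]
      refine sum_congr rfl fun j _ => ?_
      rw [real_inner_smul_left, real_inner_smul_right, walsh_eq, walsh_eq, prod_singleton,
        prod_singleton]
      ring
    rw [expect_congr rfl fun x _ => h1 x, expect_sum_comm]
    refine sum_congr rfl fun i _ => ?_
    rw [expect_sum_comm]
    have h2 : ∀ j, 𝔼 x : Hypercube n, inner ℝ (v i) (v j) * (walsh {i} x * walsh {j} x) =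
        if i = j then inner ℝ (v i) (v j) else 0 := fun j => by
      rw [← mul_expect, expect_walsh_mul_walsh]; simp
    rw [sum_congr rfl fun j _ => h2 j]
    simp
  have heven : ∀ x, F (-x) = F x := fun x => by
    have : s (-x) = -s x := by simp [hs, vertex]
    simp only [hF, this, norm_neg]
  have h0 : a ∅ = 𝔼 x, F x := by
    rw [ha, walshCoeff, expect_eq]; simp [walsh]
  have hflip : ∀ x, ((n : ℝ) - 2) * F x ≤ ∑ i, F (x * Pi.mulSingle i (-1)) := by
    intro x
    have h1 : ∀ i, s (x * Pi.mulSingle i (-1)) = s x - (2 * vertex x i) • v i := fun i => by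
      simp only [hs]
      rw [eq_sub_iff_add_eq, ← add_sum_erase _ _ (mem_univ i), ← add_sum_erase _ _ (mem_univ i),
        vertex_mul_flip, if_pos rfl, sum_congr rfl fun j hj => by
          rw [vertex_mul_flip, if_neg (ne_of_mem_erase hj)]]
      module
    have h2 : ∑ i, s (x * Pi.mulSingle i (-1)) = ((n : ℝ) - 2) • s x := by
      simp_rw [h1]
      rw [sum_sub_distrib, sum_const, card_univ, Fintype.card_fin, sub_smul,
        ← Nat.cast_smul_eq_nsmul ℝ]
      congr 1
      simp only [hs, smul_sum, smul_smul]
    calc ((n : ℝ) - 2) * F x ≤ |(n : ℝ) - 2| * F x := by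
          exact mul_le_mul_of_nonneg_right (le_abs_self _) (norm_nonneg _)
      _ = ‖∑ i, s (x * Pi.mulSingle i (-1))‖ := by rw [h2, norm_smul, Real.norm_eq_abs]
      _ ≤ _ := norm_sum_le _ _
  have hpars : 𝔼 x, F x ^ 2 = ∑ S, a S ^ 2 := by
    rw [← expect_multilin_sq]
    exact expect_congr rfl fun x _ => by rw [hFa]
  have hlow : ((n : ℝ) - 2) * 𝔼 x, F x ^ 2 ≤ ∑ S, ((n : ℝ) - 2 * #S) * a S ^ 2 := by
    calc ((n : ℝ) - 2) * 𝔼 x, F x ^ 2 = 𝔼 x, F x * (((n : ℝ) - 2) * F x) := by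
          rw [mul_expect]; exact expect_congr rfl fun x _ => by ring
      _ ≤ 𝔼 x, F x * ∑ i, F (x * Pi.mulSingle i (-1)) :=
          expect_le_expect fun x _ => mul_le_mul_of_nonneg_left (hflip x) (norm_nonneg _)
      _ = 𝔼 x : Hypercube n, multilin a (vertex x) *
            multilin (fun S => ((n : ℝ) - 2 * #S) * a S) (vertex x) :=
          expect_congr rfl fun x _ => by rw [sum_flip, hFa]
      _ = _ := by
          rw [expect_multilin_mul_multilin]
          exact sum_congr rfl fun S _ => by ring
  have hup : ∑ S, ((n : ℝ) - 2 * #S) * a S ^ 2 ≤ ((n : ℝ) - 4) * ∑ S, a S ^ 2 + 4 * a ∅ ^ 2 := by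
    have h1 : ∀ S : Finset (Fin n), ((n : ℝ) - 2 * #S) * a S ^ 2 ≤
        ((n : ℝ) - 4) * a S ^ 2 + if S = ∅ then 4 * a ∅ ^ 2 else 0 := by
      intro S
      split_ifs with h
      · subst h; simp; linarith
      · by_cases hodd : Odd #S
        · have : a S = 0 := walshCoeff_eq_zero_of_even heven hodd
          simp [this]
        · have h2 : 2 ≤ #S := by
            have := card_pos.2 (nonempty_iff_ne_empty.2 h)
            rcases Nat.lt_or_ge #S 2 with h3 | h3
            · exact absurd (by rw [show #S = 1 by omega]; exact odd_one) hodd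
            · exact h3
          have h3 : (2 : ℝ) ≤ #S := by exact_mod_cast h2
          nlinarith [sq_nonneg (a S)]
    refine (sum_le_sum fun S _ => h1 S).trans (le_of_eq ?_)
    rw [sum_add_distrib, ← mul_sum]
    simp
  have hmean : 0 ≤ 𝔼 x, F x := expect_nonneg fun x _ => norm_nonneg _
  refine Real.sqrt_le_iff.2 ⟨mul_nonneg (Real.sqrt_nonneg _) hmean, ?_⟩
  rw [mul_pow, Real.sq_sqrt zero_le_two, ← hmom, ← h0]
  rw [hpars] at hlow ⊢
  linarith

lemma sum_tensor_succ {ι : Type*} [Fintype ι] {r : ℕ} (g : (Fin (r + 1) → ι) → ℝ) :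
    ∑ s, g s = ∑ i, ∑ u, g (Fin.cons i u) := by
  rw [← Fintype.sum_prod_type']
  exact (Fintype.sum_equiv (Fin.consEquiv fun _ => ι) _ _ fun _ => rfl).symm

/-- Iterating the Khinchine–Kahane inequality over the `r` indices of a tensor. -/
lemma sqrt_sum_tensor_sq_le (r : ℕ) (A : (Fin r → Fin n) → ℝ) :
    √(∑ s, A s ^ 2) ≤ √2 ^ r *
      𝔼 X : Fin r → Hypercube n, |∑ s, A s * ∏ j, vertex (X j) (s j)| := by
  induction r with
  | zero => simp [Real.sqrt_sq_eq_abs]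
  | succ r ih =>
    have hexp : ∀ g : (Fin (r + 1) → Hypercube n) → ℝ,
        𝔼 X, g X = 𝔼 x, 𝔼 X, g (Fin.cons x X) := by
      intro g
      rw [← expect_product', univ_product_univ]
      exact (Fintype.expect_equiv (Fin.consEquiv fun _ => Hypercube n) _ _ fun _ => rfl).symm
    set v : Fin n → EuclideanSpace ℝ (Fin r → Fin n) :=
      fun i => WithLp.toLp 2 fun u => A (Fin.cons i u) with hv
    have h1 := sqrt_sum_norm_sq_le v
    have h2 : ∑ i, ‖v i‖ ^ 2 = ∑ s, A s ^ 2 := by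
      rw [sum_tensor_succ]
      exact sum_congr rfl fun i _ => by simp [EuclideanSpace.real_norm_sq_eq, hv]
    have h3 : ∀ x : Hypercube n, ‖∑ i, vertex x i • v i‖ =
        √(∑ u, (∑ i, vertex x i * A (Fin.cons i u)) ^ 2) := fun x => by
      rw [EuclideanSpace.norm_eq]
      simp [hv]
    rw [h2] at h1
    simp only [h3] at h1
    refine h1.trans ?_
    rw [hexp, pow_succ', mul_assoc]
    refine mul_le_mul_of_nonneg_left ?_ (Real.sqrt_nonneg _)
    rw [mul_expect]
    refine expect_le_expect fun x _ => ?_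
    refine (ih _).trans (le_of_eq ?_)
    congr 1
    refine expect_congr rfl fun X _ => ?_
    rw [sum_tensor_succ, sum_comm]
    congr 1
    refine sum_congr rfl fun u _ => ?_
    rw [sum_mul]
    refine sum_congr rfl fun i _ => ?_
    rw [Fin.prod_univ_succ]
    simp only [Fin.cons_zero, Fin.cons_succ]
    ring

/-- Littlewood's mixed `(ℓ₁, ℓ₂)` inequality for multilinear forms, with constant `√2 ^ r`. -/
lemma sum_sqrt_sum_tensor_sq_le {r : ℕ} {A : (Fin (r + 1) → Fin n) → ℝ} {M : ℝ}
    (hM : ∀ X : Fin (r + 1) → Hypercube n, |∑ s, A s * ∏ j, vertex (X j) (s j)| ≤ M) :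
    ∑ i, √(∑ u, A (Fin.cons i u) ^ 2) ≤ √2 ^ r * M := by
  have hpt : ∀ X : Fin r → Hypercube n,
      ∑ i, |∑ u, A (Fin.cons i u) * ∏ j, vertex (X j) (u j)| ≤ M := by
    intro X
    set D : Fin n → ℝ := fun i => ∑ u, A (Fin.cons i u) * ∏ j, vertex (X j) (u j) with hD
    set x : Hypercube n := fun i => if 0 ≤ D i then 1 else -1 with hx
    refine le_trans (le_of_eq ?_) ((le_abs_self _).trans (hM (Fin.cons x X)))
    rw [sum_tensor_succ]
    refine sum_congr rfl fun i _ => ?_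
    have h1 : ∑ u, A (Fin.cons i u) * ∏ j, vertex ((Fin.cons x X : Fin (r + 1) → Hypercube n) j)
        ((Fin.cons i u : Fin (r + 1) → Fin n) j) = vertex x i * D i := by
      rw [hD, mul_sum]
      refine sum_congr rfl fun u _ => ?_
      rw [Fin.prod_univ_succ]
      simp only [Fin.cons_zero, Fin.cons_succ]
      ring
    rw [h1]
    change |D i| = ((x i : ℤ) : ℝ) * D i
    simp only [hx]
    split_ifs with h0
    · rw [abs_of_nonneg h0]; simp
    · rw [abs_of_neg (not_le.1 h0)]; simp
  calc _ ≤ ∑ i, √2 ^ r *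
        𝔼 X : Fin r → Hypercube n, |∑ u, A (Fin.cons i u) * ∏ j, vertex (X j) (u j)| :=
        sum_le_sum fun i _ => sqrt_sum_tensor_sq_le r fun u => A (Fin.cons i u)
    _ = √2 ^ r * 𝔼 X : Fin r → Hypercube n,
          ∑ i, |∑ u, A (Fin.cons i u) * ∏ j, vertex (X j) (u j)| := by
        rw [← mul_sum, expect_sum_comm]
    _ ≤ _ := by
        gcongr
        exact expect_le univ_nonempty fun X _ => hpt X

/-! ### Random colourings -/

/-- The tensor of the part of `multilin a` that is multilinear with respect to the colour classes
of `χ : [n] → [m]`: its entry at `s` is the coefficient of `∏_j z_{s_j}`, provided that each index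
`s_j` has colour `j`. -/
def rainbowTensor {m : ℕ} (a : Finset (Fin n) → ℝ) (χ : Fin n → Fin m) : (Fin m → Fin n) → ℝ :=
  fun s => if ∀ j, χ (s j) = j then a (univ.image s) else 0

lemma injective_of_rainbow {m : ℕ} {χ : Fin n → Fin m} {s : Fin m → Fin n}
    (hs : ∀ j, χ (s j) = j) : Function.Injective s := fun i j h => by
  rw [← hs i, ← hs j, h]

lemma expect_prod_mul_prod_comp {m : ℕ} (χ : Fin n → Fin m) (S : Finset (Fin n)) :
    𝔼 ε : Hypercube m, (∏ j, vertex ε j) * ∏ i ∈ S, vertex ε (χ i) =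
      if ∀ j, Odd #{i ∈ S | χ i = j} then 1 else 0 := by
  have h1 : ∀ ε : Hypercube m, (∏ j, vertex ε j) * ∏ i ∈ S, vertex ε (χ i) =
      ∏ j, ((ε j : ℤ) : ℝ) ^ (#{i ∈ S | χ i = j} + 1) := fun ε => by
    rw [← prod_fiberwise S χ, ← prod_mul_distrib]
    refine prod_congr rfl fun j _ => ?_
    rw [prod_congr rfl fun i hi => by rw [(mem_filter.1 hi).2], prod_const, pow_succ']
    rfl
  rw [expect_congr rfl fun ε _ => h1 ε,
    expect_cube_prod fun j u => ((u : ℤ) : ℝ) ^ (#{i ∈ S | χ i = j} + 1)]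
  split_ifs with h
  · refine prod_eq_one fun j _ => ?_
    have := (h j).add_one
    simp [this.neg_one_pow]
  · push Not at h
    obtain ⟨j, hj⟩ := h
    refine prod_eq_zero (mem_univ j) ?_
    have := (Nat.not_odd_iff_even.1 hj).add_one
    simp [this.neg_one_pow]

/-- The multilinear part with respect to a colouring is bounded by the polynomial itself: it is
the average of `∏_j ε_j · P (ε_{χ(i)} z_i)_i` over signs `ε_j` attached to the colours. -/
lemma abs_sum_rainbowTensor_le {m : ℕ} {a : Finset (Fin n) → ℝ} {M : ℝ}
    (ha : ∀ S, #S ≠ m → a S = 0) (hM : ∀ x : Hypercube n, |multilin a (vertex x)| ≤ M)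
    (χ : Fin n → Fin m) (X : Fin m → Hypercube n) :
    |∑ s, rainbowTensor a χ s * ∏ j, vertex (X j) (s j)| ≤ M := by
  set z : Hypercube n := fun i => X (χ i) i with hz
  have hbij : ∑ s, rainbowTensor a χ s * ∏ j, vertex (X j) (s j) =
      ∑ S, a S * walsh S z * if ∀ j, Odd #{i ∈ S | χ i = j} then 1 else 0 := by
    have hL : ∑ s, rainbowTensor a χ s * ∏ j, vertex (X j) (s j) =
        ∑ s : Fin m → Fin n with ∀ j, χ (s j) = j, a (univ.image s) * walsh (univ.image s) z := by
      rw [sum_filter]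
      refine sum_congr rfl fun s _ => ?_
      unfold rainbowTensor
      split_ifs with h
      · rw [walsh_eq, prod_image fun i _ j _ hij => injective_of_rainbow h hij]
        congr 1
        refine prod_congr rfl fun j _ => ?_
        simp only [hz, vertex, h j]
      · rw [zero_mul]
    have hR : ∑ S, a S * walsh S z * (if ∀ j, Odd #{i ∈ S | χ i = j} then 1 else 0) =
        ∑ S with #S = m ∧ ∀ j, Odd #{i ∈ S | χ i = j}, a S * walsh S z := by
      rw [sum_filter]
      refine sum_congr rfl fun S _ => ?_
      by_cases hS : #S = m
      · simp [hS]
      · simp [hS, ha S hS]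
    rw [hL, hR]
    refine sum_nbij (fun s => univ.image s) ?_ ?_ ?_ fun _ _ => rfl
    · intro s hs
      have hs' := (mem_filter.1 hs).2
      refine mem_filter.2 ⟨mem_univ _, ?_, fun j => ?_⟩
      · rw [card_image_of_injective _ (injective_of_rainbow hs'), card_univ, Fintype.card_fin]
      · have : {i ∈ univ.image s | χ i = j} = {s j} := by
          ext i
          simp only [mem_filter, mem_image, mem_univ, true_and, mem_singleton]
          constructor
          · rintro ⟨⟨k, rfl⟩, hk⟩
            rw [hs' k] at hk
            rw [hk]
          · rintro rfl
            exact ⟨⟨j, rfl⟩, hs' j⟩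
        rw [this, card_singleton]
        exact odd_one
    · intro s hs s' hs' hss
      have h1 := (mem_filter.1 (mem_coe.1 hs)).2
      have h2 := (mem_filter.1 (mem_coe.1 hs')).2
      funext j
      have : s j ∈ univ.image s' := by
        simp only at hss
        rw [← hss]; exact mem_image_of_mem _ (mem_univ j)
      obtain ⟨k, _, hk⟩ := mem_image.1 this
      have hkj : k = j := by rw [← h2 k, hk, h1 j]
      rw [← hk, hkj]
    · intro S hS
      obtain ⟨hcard, hodd⟩ := (mem_filter.1 (mem_coe.1 hS)).2
      have hex : ∀ j, ∃ i ∈ S, χ i = j := fun j => by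
        obtain ⟨i, hi⟩ := card_pos.1 (hodd j).pos
        exact ⟨i, (mem_filter.1 hi).1, (mem_filter.1 hi).2⟩
      choose s hsS hsχ using hex
      refine ⟨s, mem_coe.2 (mem_filter.2 ⟨mem_univ _, hsχ⟩), ?_⟩
      refine eq_of_subset_of_card_le (image_subset_iff.2 fun j _ => hsS j) ?_
      rw [card_image_of_injective _ (injective_of_rainbow hsχ), card_univ, Fintype.card_fin, hcard]
  have havg : ∑ S, a S * walsh S z * (if ∀ j, Odd #{i ∈ S | χ i = j} then 1 else 0) =
      𝔼 ε : Hypercube m,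
        (∏ j, vertex ε j) * multilin a (fun i => vertex ε (χ i) * vertex z i) := by
    have h1 : ∀ ε : Hypercube m,
        (∏ j, vertex ε j) * multilin a (fun i => vertex ε (χ i) * vertex z i) =
        ∑ S, a S * walsh S z * ((∏ j, vertex ε j) * ∏ i ∈ S, vertex ε (χ i)) := fun ε => by
      rw [multilin, mul_sum]
      refine sum_congr rfl fun S _ => ?_
      rw [prod_mul_distrib, walsh_eq]; ring
    rw [expect_congr rfl fun ε _ => h1 ε, expect_sum_comm]
    refine sum_congr rfl fun S _ => ?_
    rw [← mul_expect, expect_prod_mul_prod_comp]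
  rw [hbij, havg]
  refine (abs_expect_le _ _).trans (expect_le univ_nonempty fun ε _ => ?_)
  rw [abs_mul, abs_prod, prod_congr rfl fun j _ => abs_vertex ε j, prod_const_one, one_mul]
  exact abs_multilin_le hM fun i => by rw [abs_mul, abs_vertex, abs_vertex, one_mul]

/-- In a random colouring with independent colours of distribution `p`, the probability of
prescribed colours at distinct points. -/
lemma sum_weight_of_injective {m r : ℕ} {p : Fin m → ℝ} (hp : ∑ j, p j = 1)
    {s : Fin r → Fin n} (hs : Function.Injective s) (c : Fin r → Fin m) :
    ∑ χ : Fin n → Fin m, (∏ i, p (χ i)) * (if ∀ j, χ (s j) = c j then 1 else 0) =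
      ∏ j, p (c j) := by
  have h1 : ∀ χ : Fin n → Fin m, (∏ i, p (χ i)) * (if ∀ j, χ (s j) = c j then 1 else 0) =
      ∏ i, p (χ i) * (if ∀ j, s j = i → χ i = c j then 1 else 0) := fun χ => by
    rw [prod_mul_distrib]
    congr 1
    rw [prod_ite_zero, prod_const_one]
    by_cases h : ∀ j, χ (s j) = c j
    · rw [if_pos h, if_pos fun i _ j hij => by rw [← hij, h]]
    · rw [if_neg h, if_neg fun h' => h fun j => h' _ (mem_univ _) j rfl]
  simp_rw [h1]
  rw [← Fintype.prod_sum fun i col => p col * (if ∀ j, s j = i → col = c j then 1 else 0)]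
  rw [← prod_subset (subset_univ (univ.image s)), prod_image fun i _ j _ h => hs h]
  · refine prod_congr rfl fun j _ => ?_
    have h2 : ∀ col, (∀ j', s j' = s j → col = c j') ↔ col = c j := fun col =>
      ⟨fun h => h j rfl, fun h j' hj' => by rw [hs hj', h]⟩
    simp [h2]
  · intro i _ hi
    have h2 : ∀ col, ∀ j, s j = i → col = c j := fun col j hj =>
      absurd (mem_image.2 ⟨j, mem_univ j, hj⟩) hi
    simp only [if_pos (h2 _), mul_one, hp]

/-- The upper bound also holds at points that need not be distinct: coinciding points cannot receive
distinct colours. -/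
lemma sum_weight_le {m r : ℕ} {p : Fin m → ℝ} (hp : ∑ j, p j = 1) (hp0 : ∀ j, 0 ≤ p j)
    (s : Fin r → Fin n) {c : Fin r → Fin m} (hc : Function.Injective c) :
    ∑ χ : Fin n → Fin m, (∏ i, p (χ i)) * (if ∀ j, χ (s j) = c j then 1 else 0) ≤
      ∏ j, p (c j) := by
  by_cases hs : Function.Injective s
  · exact (sum_weight_of_injective hp hs c).le
  · refine le_trans (le_of_eq ?_) (prod_nonneg fun j _ => hp0 (c j))
    refine sum_eq_zero fun χ _ => ?_
    rw [if_neg, mul_zero]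
    intro h
    exact hs fun i j hij => hc (by rw [← h i, ← h j, hij])

/-- Every `m`-set is the image of `m!` injective tuples. -/
lemma factorial_mul_sum_abs_le (a : Finset (Fin n) → ℝ) (m : ℕ) :
    (m.factorial : ℝ) * ∑ S ∈ powersetCard m univ, |a S| ≤
      ∑ s : Fin m → Fin n with Function.Injective s, |a (univ.image s)| := by
  rw [← sum_fiberwise_of_maps_to (t := powersetCard m univ) (g := fun s => univ.image s)
    fun s hs => by
      rw [mem_powersetCard]
      refine ⟨subset_univ _, ?_⟩
      rw [card_image_of_injective _ (mem_filter.1 hs).2, card_univ, Fintype.card_fin], mul_sum]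
  refine sum_le_sum fun S hS => ?_
  have hcard := (mem_powersetCard.1 hS).2
  set e := S.orderEmbOfFin hcard with he
  have h1 : m.factorial ≤
      #{s ∈ (univ : Finset (Fin m → Fin n)).filter Function.Injective | univ.image s = S} := by
    rw [← Fintype.card_fin m, ← Fintype.card_perm, ← card_univ, Fintype.card_fin]
    refine card_le_card_of_injOn (fun σ => e ∘ σ) (fun σ _ => ?_) fun σ _ τ _ h => ?_
    · refine mem_coe.2 (mem_filter.2 ⟨mem_filter.2 ⟨mem_univ _, e.injective.comp σ.injective⟩, ?_⟩)
      refine eq_of_subset_of_card_le (image_subset_iff.2 fun j _ =>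
        orderEmbOfFin_mem S hcard (σ j)) ?_
      rw [card_image_of_injective _ (e.injective.comp σ.injective), card_univ, Fintype.card_fin,
        hcard]
    · ext j
      exact congrArg Fin.val (e.injective (congrFun h j))
  rw [sum_congr rfl fun s hs => by rw [(mem_filter.1 hs).2], sum_const, nsmul_eq_mul]
  gcongr

lemma sum_abs_rainbowTensor_le {r : ℕ} {a : Finset (Fin n) → ℝ} {M : ℝ}
    (ha : ∀ S, #S ≠ r + 1 → a S = 0) (hM : ∀ x : Hypercube n, |multilin a (vertex x)| ≤ M)
    (χ : Fin n → Fin (r + 1)) :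
    ∑ s, |rainbowTensor a χ s| ≤
      √(#{u : Fin r → Fin n | ∀ j, χ (u j) = Fin.succ j} : ℝ) * (√2 ^ r * M) := by
  rw [sum_tensor_succ]
  calc _ ≤ ∑ i, √(#{u : Fin r → Fin n | ∀ j, χ (u j) = Fin.succ j} : ℝ) *
          √(∑ u, rainbowTensor a χ (Fin.cons i u) ^ 2) := by
        refine sum_le_sum fun i _ => ?_
        have h0 : ∀ u ∈ univ, |rainbowTensor a χ (Fin.cons i u)| ≠ 0 →
            ∀ j, χ (u j) = Fin.succ j := by
          intro u _ hu j
          by_contra hj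
          refine hu ?_
          rw [rainbowTensor, if_neg, abs_zero]
          exact fun h => hj (h (Fin.succ j))
        rw [← sum_filter_of_ne h0]
        refine (sum_abs_le_sqrt_card_mul _ _).trans ?_
        gcongr
        exact subset_univ _
    _ ≤ _ := by
        rw [← mul_sum]
        gcongr
        exact sum_sqrt_sum_tensor_sq_le (abs_sum_rainbowTensor_le ha hM χ)

/-- The coefficient sum of a homogeneous polynomial of degree `r + 1` by random colouring. The first
colour, whose index carries the `ℓ₁` norm, has probability `2 / (r + 2)`, the others `1 / (r + 2)`;
the bias towards the first colour gains a constant factor, which matters for small `r`. -/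
lemma sum_abs_coeff_le_of_colouring {r : ℕ} {a : Finset (Fin n) → ℝ} {M : ℝ}
    (ha : ∀ S, #S ≠ r + 1 → a S = 0) (hM : ∀ x : Hypercube n, |multilin a (vertex x)| ≤ M) :
    (r + 1).factorial * (2 / ((r : ℝ) + 2) ^ (r + 1)) * ∑ S ∈ powersetCard (r + 1) univ, |a S| ≤
      √((n : ℝ) ^ r * (1 / ((r : ℝ) + 2)) ^ r) * (√2 ^ r * M) := by
  have hM0 : 0 ≤ M := (abs_nonneg _).trans (hM 1)
  have hr : (0 : ℝ) < r + 2 := by positivity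
  set p : Fin (r + 1) → ℝ := Fin.cons (2 / ((r : ℝ) + 2)) fun _ => 1 / ((r : ℝ) + 2) with hp
  have hp0 : ∀ j, 0 ≤ p j := fun j => by
    refine Fin.cases ?_ (fun j => ?_) j
    · simp only [hp, Fin.cons_zero]; positivity
    · simp only [hp, Fin.cons_succ]; positivity
  have hp1 : ∑ j, p j = 1 := by
    rw [Fin.sum_univ_succ]
    simp only [hp, Fin.cons_zero, Fin.cons_succ, sum_const, card_univ, Fintype.card_fin,
      nsmul_eq_mul]
    field_simp; ring
  have hpprod : ∏ j, p j = 2 / ((r : ℝ) + 2) ^ (r + 1) := by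
    rw [Fin.prod_univ_succ]
    simp only [hp, Fin.cons_zero, Fin.cons_succ, prod_const, card_univ, Fintype.card_fin]
    rw [one_div, inv_pow, pow_succ]; field_simp
  set w : (Fin n → Fin (r + 1)) → ℝ := fun χ => ∏ i, p (χ i) with hw
  have hw0 : ∀ χ, 0 ≤ w χ := fun χ => prod_nonneg fun i _ => hp0 _
  have hw1 : ∑ χ, w χ = 1 := by
    rw [hw, ← Fintype.prod_sum fun (_ : Fin n) col => p col]
    simp [hp1]
  set N : (Fin n → Fin (r + 1)) → ℝ :=
    fun χ => #{u : Fin r → Fin n | ∀ j, χ (u j) = Fin.succ j} with hN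
  have hlow : (r + 1).factorial * (2 / ((r : ℝ) + 2) ^ (r + 1)) *
      ∑ S ∈ powersetCard (r + 1) univ, |a S| ≤ ∑ χ, w χ * ∑ s, |rainbowTensor a χ s| := by
    have h1 : ∑ χ, w χ * ∑ s, |rainbowTensor a χ s| =
        ∑ s : Fin (r + 1) → Fin n, |a (univ.image s)| *
          ∑ χ : Fin n → Fin (r + 1), w χ * (if ∀ j, χ (s j) = id j then 1 else 0) := by
      simp_rw [mul_sum]
      rw [sum_comm]
      refine sum_congr rfl fun s _ => sum_congr rfl fun χ _ => ?_
      simp only [rainbowTensor, id]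
      split_ifs <;> simp [mul_comm]
    rw [h1]
    calc _ = (2 / ((r : ℝ) + 2) ^ (r + 1)) *
          ((r + 1).factorial * ∑ S ∈ powersetCard (r + 1) univ, |a S|) := by ring
      _ ≤ (2 / ((r : ℝ) + 2) ^ (r + 1)) *
          ∑ s : Fin (r + 1) → Fin n with Function.Injective s, |a (univ.image s)| := by
          gcongr
          exact factorial_mul_sum_abs_le a (r + 1)
      _ = ∑ s : Fin (r + 1) → Fin n with Function.Injective s, |a (univ.image s)| *
          ∑ χ : Fin n → Fin (r + 1), w χ * (if ∀ j, χ (s j) = id j then 1 else 0) := by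
          rw [mul_sum]
          refine sum_congr rfl fun s hs => ?_
          rw [sum_weight_of_injective hp1 (mem_filter.1 hs).2 id]
          simp only [id, hpprod]; ring
      _ ≤ _ := by
          refine sum_le_sum_of_subset_of_nonneg (filter_subset _ _) fun s _ _ => ?_
          refine mul_nonneg (abs_nonneg _) (sum_nonneg fun χ _ => mul_nonneg (hw0 χ) ?_)
          split_ifs <;> norm_num
  have hNavg : ∑ χ, w χ * N χ ≤ (n : ℝ) ^ r * (1 / ((r : ℝ) + 2)) ^ r := by
    have h1 : ∑ χ, w χ * N χ = ∑ u : Fin r → Fin n,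
        ∑ χ : Fin n → Fin (r + 1), w χ * (if ∀ j, χ (u j) = Fin.succ j then 1 else 0) := by
      rw [sum_comm]
      refine sum_congr rfl fun χ _ => ?_
      rw [← mul_sum]
      simp only [hN, card_filter]
      push_cast
      rfl
    rw [h1]
    calc _ ≤ ∑ u : Fin r → Fin n, ∏ j : Fin r, p (Fin.succ j) :=
          sum_le_sum fun u _ => sum_weight_le hp1 hp0 u (Fin.succ_injective r)
      _ = _ := by simp [hp]
  have hjensen : ∑ χ, w χ * √(N χ) ≤ √(∑ χ, w χ * N χ) := by
    refine Real.le_sqrt_of_sq_le ?_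
    have h1 := sum_mul_sq_le_sq_mul_sq univ (fun χ => √(w χ)) (fun χ => √(w χ) * √(N χ))
    have h2 : ∀ χ, √(w χ) * (√(w χ) * √(N χ)) = w χ * √(N χ) := fun χ => by
      rw [← mul_assoc, Real.mul_self_sqrt (hw0 χ)]
    have h3 : ∀ χ, (√(w χ) * √(N χ)) ^ 2 = w χ * N χ := fun χ => by
      rw [mul_pow, Real.sq_sqrt (hw0 χ), Real.sq_sqrt (Nat.cast_nonneg _)]
    have h4 : ∀ χ, √(w χ) ^ 2 = w χ := fun χ => Real.sq_sqrt (hw0 χ)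
    simp only [h2, h3, h4, hw1, one_mul] at h1
    exact h1
  calc _ ≤ ∑ χ, w χ * ∑ s, |rainbowTensor a χ s| := hlow
    _ ≤ ∑ χ, w χ * (√(N χ) * (√2 ^ r * M)) :=
        sum_le_sum fun χ _ =>
          mul_le_mul_of_nonneg_left (sum_abs_rainbowTensor_le ha hM χ) (hw0 χ)
    _ = (∑ χ, w χ * √(N χ)) * (√2 ^ r * M) := by
        rw [sum_mul]; exact sum_congr rfl fun χ _ => by ring
    _ ≤ _ := by
        refine mul_le_mul_of_nonneg_right (hjensen.trans (Real.sqrt_le_sqrt hNavg)) (by positivity)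

/-! ### The three estimates -/

lemma succ_pow_le_three_mul_pow {m : ℕ} (hm : 1 ≤ m) : ((m : ℝ) + 1) ^ m ≤ 3 * (m : ℝ) ^ m := by
  have hm0 : (0 : ℝ) < m := by exact_mod_cast hm
  calc ((m : ℝ) + 1) ^ m = (1 / m + 1) ^ m * (m : ℝ) ^ m := by
        rw [← mul_pow]; congr 1; field_simp; ring
    _ ≤ (Real.exp (1 / m)) ^ m * (m : ℝ) ^ m := by
        gcongr; exact Real.add_one_le_exp _
    _ = Real.exp 1 * (m : ℝ) ^ m := by
        rw [← Real.exp_nat_mul]; congr 2; field_simp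
    _ ≤ 3 * (m : ℝ) ^ m := by
        gcongr; linarith [Real.exp_one_lt_d9]

/-- The numerical inequality that turns the constant of the colouring argument into
`m ^ (-m / 20)`; the case `m = 2` is nearly an equality and limits
the exponent. -/
lemma succ_pow_mul_two_pow_mul_rpow_le {m : ℕ} (hm : 1 ≤ m) :
    ((m : ℝ) + 1) ^ (m + 1) * 2 ^ m * (m : ℝ) ^ ((m : ℝ) / 10) ≤ 8 * (m.factorial : ℝ) ^ 4 := by
  rcases hm.eq_or_lt with rfl | hm
  · norm_num
  induction m, Nat.succ_le_of_lt hm using Nat.le_induction with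
  | base =>
    have h : (2 : ℝ) ^ ((2 : ℝ) / 10) ≤ 1.18 := by
      calc (2 : ℝ) ^ ((2 : ℝ) / 10) ≤ (1.18 ^ 5 : ℝ) ^ ((2 : ℝ) / 10) := by
            refine Real.rpow_le_rpow ?_ ?_ ?_ <;> norm_num
        _ = 1.18 := by
            rw [← Real.rpow_natCast, ← Real.rpow_mul (by norm_num)]; norm_num
    norm_num [Nat.factorial] at h ⊢
    linarith
  | succ m hm' ih =>
    have hm2 : 2 ≤ m := hm'
    have ih := ih (by omega) (by omega)
    have hmr : (2 : ℝ) ≤ m := by exact_mod_cast hm2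
    have hm0 : (0 : ℝ) < m := by linarith
    have h1 : ((m : ℝ) + 2) ^ (m + 2) ≤ 3 * (m + 2) * (m + 1) ^ (m + 1) := by
      have := succ_pow_le_three_mul_pow (m := m + 1) (by omega)
      push_cast at this
      rw [show (m : ℝ) + 1 + 1 = m + 2 by ring] at this
      calc ((m : ℝ) + 2) ^ (m + 2) = (m + 2) * (m + 2) ^ (m + 1) := by ring
        _ ≤ (m + 2) * (3 * (m + 1) ^ (m + 1)) := by gcongr
        _ = _ := by ring
    have h2 : ((m : ℝ) + 1) ^ (((m : ℝ) + 1) / 10) ≤ (m + 1) * (m : ℝ) ^ ((m : ℝ) / 10) := by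
      have e1 : ((m : ℝ) + 1) ^ (((m : ℝ) + 1) / 10) =
          (((m : ℝ) + 1) ^ m) ^ (1 / 10 : ℝ) * ((m : ℝ) + 1) ^ (1 / 10 : ℝ) := by
        rw [← Real.rpow_natCast, ← Real.rpow_mul (by positivity),
          ← Real.rpow_add (by positivity)]
        congr 1; ring
      have e2 : (m : ℝ) ^ ((m : ℝ) / 10) = ((m : ℝ) ^ m) ^ (1 / 10 : ℝ) := by
        rw [← Real.rpow_natCast, ← Real.rpow_mul hm0.le]
        congr 1; ring
      rw [e1, e2]
      calc _ ≤ (((m : ℝ) + 1) * (m : ℝ) ^ m) ^ (1 / 10 : ℝ) * ((m : ℝ) + 1) ^ (1 / 10 : ℝ) := by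
            gcongr
            refine (succ_pow_le_three_mul_pow (by omega)).trans ?_
            gcongr
            linarith
        _ = ((m : ℝ) + 1) ^ (1 / 10 + 1 / 10 : ℝ) * ((m : ℝ) ^ m) ^ (1 / 10 : ℝ) := by
            rw [Real.mul_rpow (by positivity) (by positivity), Real.rpow_add (by positivity)]
            ring
        _ ≤ ((m : ℝ) + 1) ^ (1 : ℝ) * ((m : ℝ) ^ m) ^ (1 / 10 : ℝ) := by
            gcongr
            · linarith
            · norm_num
        _ = _ := by rw [Real.rpow_one]
    rw [Nat.factorial_succ]
    push_cast
    rw [show (m : ℝ) + 1 + 1 = m + 2 by ring]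
    calc ((m : ℝ) + 2) ^ (m + 1 + 1) * 2 ^ (m + 1) * ((m : ℝ) + 1) ^ (((m : ℝ) + 1) / 10)
        ≤ (3 * (m + 2) * (m + 1) ^ (m + 1)) * 2 ^ (m + 1) *
          ((m + 1) * (m : ℝ) ^ ((m : ℝ) / 10)) := by gcongr
      _ = (6 * (m + 2) * (m + 1)) *
          (((m : ℝ) + 1) ^ (m + 1) * 2 ^ m * (m : ℝ) ^ ((m : ℝ) / 10)) := by ring
      _ ≤ (((m : ℝ) + 1) ^ 3 * (m + 1)) * (8 * (m.factorial : ℝ) ^ 4) := by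
          refine mul_le_mul ?_ ih (by positivity) (by positivity)
          gcongr
          nlinarith [mul_nonneg hm0.le (sq_nonneg ((m : ℝ) - 2))]
      _ = _ := by ring

lemma levelL1_eq (f : Hypercube n → ℝ) (l : ℕ) :
    levelL1 f l = ∑ S ∈ powersetCard l univ, |homPart (walshCoeff f) l S| :=
  sum_congr rfl fun S hS => by rw [homPart, if_pos (mem_powersetCard.1 hS).2]

/-- The level-`l` part of a bounded function of degree at most `d` is bounded by `d ^ l / l!`. -/
lemma abs_multilin_level_le {d : ℕ} {f : Hypercube n → ℝ}
    (hf : ∀ x, f x ∈ Set.Icc (-1 : ℝ) 1) (hd : HasDegreeAtMost f d) (l : ℕ) (x : Hypercube n) :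
    |multilin (homPart (walshCoeff f) l) (vertex x)| ≤ (d : ℝ) ^ l / l.factorial := by
  have h := abs_multilin_homPart_le (a := walshCoeff f) (M := 1) hd
    (fun x => by rw [multilin_walshCoeff]; exact abs_le.2 (hf x)) l
    (z := vertex x) fun i => (abs_vertex x i).le
  rwa [one_mul] at h

lemma levelL1_le_sharpBound {d l : ℕ} {f : Hypercube n → ℝ}
    (hf : ∀ x, f x ∈ Set.Icc (-1 : ℝ) 1) (hd : HasDegreeAtMost f d) (hl : 1 ≤ l) (hln : l ≤ n) :
    levelL1 f l ≤ sharpBound 23 n d l := by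
  have hhom := homPart_of_card_ne (walshCoeff f) l
  have hM := abs_multilin_level_le hf hd l
  rw [levelL1_eq, sharpBound]
  rcases hl.eq_or_lt with rfl | hl2
  -- For `l = 1` both extra factors are `1`; one colour gives the bound without any loss.
  · have h := sum_abs_coeff_le_of_colouring (r := 0) hhom hM
    norm_num at h ⊢
    exact h
  · obtain ⟨k, hk2, hkl, hk⟩ := exists_free_index_count hl2
    refine (sum_abs_coeff_le hk2 hkl hln hhom hM).trans ?_
    rw [mul_assoc ((n.choose l : ℝ) ^ _)]
    refine mul_le_mul_of_nonneg_left ?_ (Real.rpow_nonneg (Nat.cast_nonneg _) _)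
    refine le_trans (le_of_eq ?_)
      (mul_le_mul_of_nonneg_right hk (by positivity : (0 : ℝ) ≤ (d : ℝ) ^ l / l.factorial))
    ring

lemma levelL1_le_simpleBound {d l : ℕ} {f : Hypercube n → ℝ}
    (hf : ∀ x, f x ∈ Set.Icc (-1 : ℝ) 1) (hd : HasDegreeAtMost f d) (hl : 1 ≤ l) :
    levelL1 f l ≤ simpleBound (1 / 20) n d l := by
  obtain ⟨r, rfl⟩ : ∃ r, l = r + 1 := ⟨l - 1, by omega⟩
  have h := sum_abs_coeff_le_of_colouring (r := r) (homPart_of_card_ne (walshCoeff f) (r + 1))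
    (abs_multilin_level_le hf hd (r + 1))
  rw [← levelL1_eq] at h
  have hr : (0 : ℝ) < r + 2 := by positivity
  set F : ℝ := ((r + 1).factorial : ℝ) with hF
  have hF0 : 0 < F := Nat.cast_pos.2 (Nat.factorial_pos _)
  set G : ℝ := √((2 / ((r : ℝ) + 2)) ^ r) with hG
  have hm0 : (0 : ℝ) < ((r + 1 : ℕ) : ℝ) := by positivity
  set Y : ℝ := ((r + 1 : ℕ) : ℝ) ^ (((r + 1 : ℕ) : ℝ) / 20) with hY
  have hY0 : 0 < Y := by positivity
  have hroot : √((n : ℝ) ^ r * (1 / ((r : ℝ) + 2)) ^ r) * √2 ^ r = √((n : ℝ) ^ r) * G := by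
    have h1 : √2 ^ r = √((2 : ℝ) ^ r) := by
      rw [Real.sqrt_eq_rpow, Real.sqrt_eq_rpow, ← Real.rpow_natCast, ← Real.rpow_natCast,
        ← Real.rpow_mul zero_le_two, ← Real.rpow_mul zero_le_two, mul_comm]
    rw [h1, ← Real.sqrt_mul (by positivity), hG, ← Real.sqrt_mul (by positivity)]
    congr 1
    rw [div_pow, div_pow, one_pow]; ring
  have hn : √((n : ℝ) ^ r) = (n : ℝ) ^ ((((r + 1 : ℕ) : ℝ) - 1) / 2) := by
    rw [Real.sqrt_eq_rpow, ← Real.rpow_natCast, ← Real.rpow_mul (Nat.cast_nonneg _)]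
    congr 1; push_cast; ring
  have hnum : ((r : ℝ) + 2) ^ (r + 1) * G * Y ≤ 2 * F ^ 2 := by
    refine le_of_sq_le_sq ?_ (by positivity)
    have h1 := succ_pow_mul_two_pow_mul_rpow_le (m := r + 1) (by omega)
    have hY2 : Y ^ 2 = ((r + 1 : ℕ) : ℝ) ^ (((r + 1 : ℕ) : ℝ) / 10) := by
      rw [hY, ← Real.rpow_natCast, ← Real.rpow_mul hm0.le]
      congr 1; push_cast; ring
    rw [← hY2, ← hF, show ((r + 1 : ℕ) : ℝ) + 1 = r + 2 by push_cast; ring] at h1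
    have hG2 : ((r : ℝ) + 2) ^ r * G ^ 2 = 2 ^ r := by
      rw [hG, Real.sq_sqrt (by positivity), ← mul_pow]
      congr 1; field_simp
    calc (((r : ℝ) + 2) ^ (r + 1) * G * Y) ^ 2
        = ((r : ℝ) + 2) ^ (r + 2) * (((r : ℝ) + 2) ^ r * G ^ 2) * Y ^ 2 := by ring
      _ = ((r : ℝ) + 2) ^ (r + 1 + 1) * 2 ^ (r + 1) * Y ^ 2 / 2 := by rw [hG2]; ring
      _ ≤ 8 * F ^ 4 / 2 := by gcongr
      _ = _ := by ring
  rw [simpleBound, ← hn, show -(1 / 20 * ((r + 1 : ℕ) : ℝ)) = -(((r + 1 : ℕ) : ℝ) / 20) by ring,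
    Real.rpow_neg hm0.le, ← hY, ← div_eq_mul_inv, le_div_iff₀ hY0]
  rw [← mul_assoc, hroot] at h
  have hP : (0 : ℝ) < ((r : ℝ) + 2) ^ (r + 1) := by positivity
  have hc : 0 < 2 * F ^ 2 := by positivity
  refine le_of_mul_le_mul_left ?_ hc
  calc 2 * F ^ 2 * (levelL1 f (r + 1) * Y)
      = F * ((r : ℝ) + 2) ^ (r + 1) * Y *
        (F * (2 / ((r : ℝ) + 2) ^ (r + 1)) * levelL1 f (r + 1)) := by field_simp
    _ ≤ F * ((r : ℝ) + 2) ^ (r + 1) * Y * (√((n : ℝ) ^ r) * G * ((d : ℝ) ^ (r + 1) / F)) := by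
        gcongr
    _ = (((r : ℝ) + 2) ^ (r + 1) * G * Y) * (√((n : ℝ) ^ r) * (d : ℝ) ^ (r + 1)) := by
        field_simp
    _ ≤ 2 * F ^ 2 * (√((n : ℝ) ^ r) * (d : ℝ) ^ (r + 1)) := by gcongr

lemma sharpBound_le_simpleBound {d l : ℕ} (hl : 2500 ≤ l) :
    sharpBound 23 n d l ≤ simpleBound (1 / 20) n d l := by
  have hlr : (2500 : ℝ) ≤ l := by exact_mod_cast hl
  have hl0 : (0 : ℝ) < l := by linarith
  set L := Real.log l with hL
  have hL4 : 4 ≤ L := by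
    rw [hL, Real.le_log_iff_exp_le hl0]
    calc Real.exp 4 = Real.exp 1 ^ 4 := by rw [← Real.exp_nat_mul]; norm_num
      _ ≤ 3 ^ 4 := by gcongr; linarith [Real.exp_one_lt_d9]
      _ ≤ l := by linarith
  have hchoose : (n.choose l : ℝ) ^ (((l : ℝ) - 1) / (2 * l)) ≤ (n : ℝ) ^ (((l : ℝ) - 1) / 2) := by
    calc (n.choose l : ℝ) ^ (((l : ℝ) - 1) / (2 * l))
        ≤ ((n : ℝ) ^ l) ^ (((l : ℝ) - 1) / (2 * l)) := by
          refine Real.rpow_le_rpow (Nat.cast_nonneg _) (by exact_mod_cast Nat.choose_le_pow n l) ?_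
          exact div_nonneg (by linarith) (by linarith)
      _ = _ := by
          rw [← Real.rpow_natCast, ← Real.rpow_mul (Nat.cast_nonneg _)]
          congr 1; field_simp
  -- `(l / e) ^ l ≤ l!`
  have hfact : Real.exp (l * L - l) ≤ l.factorial := by
    have h1 := Real.pow_div_factorial_le_exp (l : ℝ) hl0.le l
    rw [div_le_iff₀ (by positivity)] at h1
    rw [Real.exp_sub, div_le_iff₀ (Real.exp_pos _), hL, Real.exp_nat_mul, Real.exp_log hl0]
    linarith
  -- Since `46 ^ 2 ≤ 2500`, the subexponential factor costs at most half of `l * log l`.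
  have hsqrt : 46 * √(l * L) ≤ l * L := by
    have h1 : 46 ≤ √(l * L) := Real.le_sqrt_of_sq_le (by nlinarith)
    nlinarith [Real.mul_self_sqrt (by positivity : 0 ≤ l * L)]
  have hmain : Real.exp (23 * √(l * L)) / l.factorial ≤ (l : ℝ) ^ (-(1 / 20 * (l : ℝ))) := by
    rw [div_le_iff₀ (by positivity), Real.rpow_def_of_pos hl0, ← hL]
    calc Real.exp (23 * √(l * L)) ≤ Real.exp (L * -(1 / 20 * l)) * Real.exp (l * L - l) := by
          rw [← Real.exp_add]
          refine Real.exp_le_exp.2 ?_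
          nlinarith
      _ ≤ _ := by gcongr
  rw [sharpBound, simpleBound]
  calc _ ≤ (n : ℝ) ^ (((l : ℝ) - 1) / 2) * Real.exp (23 * √(l * L)) *
        ((d : ℝ) ^ l / l.factorial) := by gcongr
    _ = (n : ℝ) ^ (((l : ℝ) - 1) / 2) * (d : ℝ) ^ l *
        (Real.exp (23 * √(l * L)) / l.factorial) := by ring
    _ ≤ _ := by gcongr

end CubeFourier

theorem mainTheorem3 :
    ∃ κ : ℝ, 0 < κ ∧ ∃ c : ℝ, 0 < c ∧ c < 1 ∧ ∃ l₀ : ℕ,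
      ∀ (n d : ℕ), 1 ≤ d → d ≤ n →
        ∀ f : Hypercube n → ℝ, (∀ x, f x ∈ Set.Icc (-1 : ℝ) 1) → HasDegreeAtMost f d →
          ∀ l : ℕ, 1 ≤ l → l ≤ d →
            levelL1 f l ≤ sharpBound κ n d l ∧
            levelL1 f l ≤ simpleBound c n d l ∧
            (l₀ ≤ l → sharpBound κ n d l ≤ simpleBound c n d l) := by
  refine ⟨23, by norm_num, 1 / 20, by norm_num, by norm_num, 2500, ?_⟩
  intro n d _ hdn f hf hdeg l hl hld
  exact ⟨CubeFourier.levelL1_le_sharpBound hf hdeg hl (hld.trans hdn),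
    CubeFourier.levelL1_le_simpleBound hf hdeg hl, CubeFourier.sharpBound_le_simpleBound⟩
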